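/- Theorem 1. Let $G$ be a finite simple connected graph. The great shadow $S(G)$ is the graph obtained from $G$ by adding, for each vertex $v$ of $G$, a new vertex $v'$ adjacent to $v$ and to all neighbours of $v$ in $G$ (and to no other vertex, so that no two new vertices are adjacent). Then $S(G)$ is planar if and only if $G$ is a bipartite cactus graph, that is, $G$ is bipartite and no two distinct cycles of $G$ share an edge. -/

import Mathlib

namespace SimpleGraph

/-- The great shadow `S(G)` of a graph `G`, on two copies of the vertex set: `Sum.inl v` is the
original vertex `v`, and `Sum.inr v` is its shadow vertex `v'`. The original vertices span `G`,
the vertex `v'` is adjacent to `v` and to all neighbours of `v` in `G`, and no two shadow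
vertices are adjacent. -/
def greatShadow {V : Type*} (G : SimpleGraph V) : SimpleGraph (V ⊕ V) where
  Adj
    | Sum.inl u, Sum.inl v => G.Adj u v
    | Sum.inl u, Sum.inr v => u = v ∨ G.Adj u v
    | Sum.inr u, Sum.inl v => u = v ∨ G.Adj u v
    | Sum.inr _, Sum.inr _ => False
  symm := ⟨by
    rintro (u | u) (v | v) h
    · exact G.adj_symm h
    · exact h.imp Eq.symm (fun h' => G.adj_symm h')
    · exact h.imp Eq.symm (fun h' => G.adj_symm h')
    · exact h⟩
  loopless := ⟨by
    rintro (v | v) h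
    · exact G.irrefl h
    · exact h⟩

/-- A drawing of a graph in the plane without crossings: the vertices are distinct points, every
edge is a simple (Jordan) arc joining its two ends, an edge passes through no vertex other than
its ends, and two distinct edges meet at most in a common end. -/
structure PlaneDrawing {W : Type*} (H : SimpleGraph W) where
  /-- The point that represents a vertex. -/
  point : W → ℝ × ℝ
  /-- The set of points on an edge (of no significance for a pair that is not an edge). -/
  arc : Sym2 W → Set (ℝ × ℝ)
  point_injective : Function.Injective point
  exists_path : ∀ u v : W, H.Adj u v →
    ∃ γ : _root_.Path (point u) (point v), Function.Injective γ ∧ Set.range γ = arc s(u, v)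
  mem_of_point_mem_arc : ∀ e ∈ H.edgeSet, ∀ w : W, point w ∈ arc e → w ∈ e
  arc_inter_arc : ∀ e ∈ H.edgeSet, ∀ f ∈ H.edgeSet, e ≠ f →
    ∀ x ∈ arc e ∩ arc f, ∃ w : W, w ∈ e ∧ w ∈ f ∧ x = point w

/-- A (finite) graph is planar if it can be drawn in the plane without crossings. -/
def IsPlanar {W : Type*} (H : SimpleGraph W) : Prop :=
  Nonempty H.PlaneDrawing

/-- A cactus is a connected graph in which no two distinct cycles share an edge. Cycles are
compared as subgraphs, so that neither the starting point nor the direction matters. -/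
def IsCactus {V : Type*} (G : SimpleGraph V) : Prop :=
  G.Connected ∧
    ∀ (u v : V) (p : G.Walk u u) (q : G.Walk v v), p.IsCycle → q.IsCycle →
      p.toSubgraph ≠ q.toSubgraph → ∀ e : Sym2 V, ¬ (e ∈ p.edges ∧ e ∈ q.edges)

end SimpleGraph

/-!
The great shadow `S(G)` is planar exactly for bipartite cactus graphs.

*Non-planarity.* Everything comes from one topological fact, `not_exists_weak_drawing_K33`: there are
no nine curves in the plane joining three points to three points such that curves without a common
end are disjoint. For two disjoint curves `γ`, `δ`, the difference `γ s - δ t` has a continuous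
logarithm on the square of parameters, so the angles through which it turns along the four sides of
the square add up to zero. The eighteen relations obtained in this way from the pairs of independent
edges of `K₃,₃` contradict each other modulo two. Since the curves need not be simple, it suffices to
find in `S(G)` a `K₃,₃` whose edges are walks, with disjoint walks for independent edges
(`IsPlanar.not_exists_K33_of_walks`).

* For an odd cycle with consecutive vertices `a`, `v`, `c` the parts are `c`, `a`, `v` and
  `a'`, `c'`, `v'`. The missing edges `ca'` and `ac'` are the two lifts of the rest of the cycle that
  alternate between original vertices and shadows (`not_isPlanar_of_odd_path`).
* If two cycles share an edge, then at the vertex `x` where they part three neighbours of `x` lie in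
  one component of `G - x`; this is the property `HasTripleBranch`. The parts are then `x`, `x'` and
  `y'` for the centre `y` of a tripod in `G - x`, and the three neighbours
  (`HasTripleBranch.not_isPlanar`).

*Planarity.* A cactus graph has no triple branch, and then it is an edge or an even cycle attached at
a vertex `x` to a smaller graph of the same kind (`exists_end_block`; the cycle is even if the graph
is bipartite). So `S(G)` consists of the great shadows of the two parts, glued along the edge `xx'`.
A straight-line drawing of the first part leaves a thin triangle at this edge empty, and the great
shadow of the end block fits into it (`IsStraightDrawingOn.exists_union`). The latter is a closed
ladder whose rungs join the vertices to their shadows, with one diagonal in each quadrilateral, because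
the original vertices lie alternately on the left and on the right; for this the cycle has to be even.
It is drawn in `LadderEdge.meetInEnds` with explicit coordinates.
-/

/-! ### Curves in the plane and `K₃,₃` -/

open Complex in
/-- The total change of a continuous logarithm of `f : ℝ → ℂ` over `[0, 1]`; its imaginary part is
the angle through which `f` turns around the origin. The value is `0` if `f` has no continuous
logarithm. -/
noncomputable def logChange (f : ℝ → ℂ) : ℂ :=
  open Classical in
  if h : ∃ g : ℝ → ℂ, Continuous g ∧ ∀ t, exp (g t) = f t then h.choose 1 - h.choose 0 else 0

lemma exists_continuous_log {A : Type*} [TopologicalSpace A] [SimplyConnectedSpace A]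
    [LocallyPathConnectedSpace A] {f : A → ℂ} (hf : Continuous f) (h0 : ∀ a, f a ≠ 0) :
    ∃ g : A → ℂ, Continuous g ∧ ∀ a, Complex.exp (g a) = f a := by
  obtain ⟨a₀⟩ : Nonempty A := inferInstance
  obtain ⟨F, ⟨-, hF⟩, -⟩ := Complex.isCoveringMapOn_exp.existsUnique_continuousMap_lifts
    ⟨f, hf⟩ (a₀ := a₀) (e₀ := Complex.log (f a₀)) (Complex.exp_log (h0 a₀)) h0
  exact ⟨F, F.continuous, fun a => congrFun hF a⟩

/-- The change of a continuous logarithm does not depend on the logarithm, since two logarithms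
with the same initial value agree. -/
lemma logChange_eq {f g : ℝ → ℂ} (hg : Continuous g) (hgf : ∀ t, Complex.exp (g t) = f t) :
    logChange f = g 1 - g 0 := by
  have hex : ∃ g : ℝ → ℂ, Continuous g ∧ ∀ t, Complex.exp (g t) = f t := ⟨g, hg, hgf⟩
  rw [logChange, dif_pos hex]
  obtain ⟨hk, hkf⟩ := hex.choose_spec
  set k := hex.choose
  have hf : Continuous f := by
    have : f = fun t => Complex.exp (g t) := funext fun t => (hgf t).symm
    rw [this]; fun_prop
  obtain ⟨F, -, hF⟩ := Complex.isCoveringMapOn_exp.existsUnique_continuousMap_lifts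
    ⟨f, hf⟩ (a₀ := (0 : ℝ)) (e₀ := g 0) (hgf 0) (fun t => by
      have := Complex.exp_ne_zero (g t)
      rw [hgf t] at this
      exact this)
  have h1 := hF ⟨g, hg⟩ ⟨rfl, funext hgf⟩
  have h2 := hF ⟨fun t => k t + (g 0 - k 0), by fun_prop⟩ ⟨by simp, by
    funext t
    have h3 : Complex.exp (g 0 - k 0) = 1 := by
      rw [Complex.exp_sub, hgf, hkf, div_self]
      rw [← hkf 0]
      exact Complex.exp_ne_zero _
    simp [Complex.exp_add, h3, hkf]⟩
  have h4 := congrArg (fun F : C(ℝ, ℂ) => F 1) (h2.trans h1.symm)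
  simp only [ContinuousMap.coe_mk] at h4
  linear_combination h4

lemma exp_logChange {f : ℝ → ℂ} (hf : Continuous f) (h0 : ∀ t, f t ≠ 0) :
    Complex.exp (logChange f) = f 1 / f 0 := by
  obtain ⟨g, hg, hgf⟩ := exists_continuous_log hf h0
  rw [logChange_eq hg hgf, Complex.exp_sub, hgf, hgf]

/-- For two disjoint curves, the difference of a point of the first and a point of the second has a
continuous logarithm on the square of parameters, so the changes along its boundary add up to
zero. -/
lemma logChange_square {γ δ : ℝ → ℂ} (hγ : Continuous γ) (hδ : Continuous δ)
    (h : ∀ s t, γ s ≠ δ t) :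
    logChange (fun s => γ s - δ 0) + logChange (fun t => δ t - γ 1) =
      logChange (fun s => γ s - δ 1) + logChange (fun t => δ t - γ 0) := by
  obtain ⟨G, hG, hGf⟩ := exists_continuous_log (A := ℝ × ℝ) (f := fun x => γ x.1 - δ x.2)
    (by fun_prop) (fun x => sub_ne_zero.2 (h _ _))
  have h1 (t : ℝ) : logChange (fun s => γ s - δ t) = G (1, t) - G (0, t) :=
    logChange_eq (g := fun s => G (s, t)) (by fun_prop) (fun s => hGf (s, t))
  have h2 (s : ℝ) : logChange (fun t => δ t - γ s) = G (s, 1) - G (s, 0) := by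
    rw [logChange_eq (g := fun t => G (s, t) + Real.pi * Complex.I) (by fun_prop)]
    · ring
    · intro t
      rw [Complex.exp_add, hGf, Complex.exp_pi_mul_I]
      ring
  rw [h1, h1, h2, h2]
  ring

/-- There are branches of the logarithm on the nonzero numbers of the form `ℓ z + π i p z` with `ℓ`
even and with `p` an integer that takes opposite parities at `z` and `-z`. -/
lemma exists_even_halfLog : ∃ (ℓ : ℂ → ℂ) (p : ℂ → ℤ), (∀ z, ℓ (-z) = ℓ z) ∧
    (∀ z, z ≠ 0 → p z + p (-z) = 1) ∧
    ∀ z, z ≠ 0 → Complex.exp (ℓ z + Real.pi * Complex.I * p z) = z := by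
  classical
  let ℓ : ℂ → ℂ := fun z => Complex.log (z ^ 2) / 2
  have hev : ∀ z, ℓ (-z) = ℓ z := fun z => by simp [ℓ]
  have hsq : ∀ z, z ≠ 0 → Complex.exp (ℓ z) = z ∨ Complex.exp (ℓ z) = -z := by
    intro z hz
    rw [← sq_eq_sq_iff_eq_or_eq_neg, ← Complex.exp_nat_mul]
    have : ((2 : ℕ) : ℂ) * ℓ z = Complex.log (z ^ 2) := by
      simp only [ℓ]; push_cast; ring
    rw [this, Complex.exp_log (pow_ne_zero 2 hz)]
  have hne : ∀ z : ℂ, z ≠ 0 → z ≠ -z := fun z hz h => hz (self_eq_neg.1 h)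
  refine ⟨ℓ, fun z => if Complex.exp (ℓ z) = z then 0 else 1, hev, fun z hz => ?_, fun z hz => ?_⟩
  · simp only [hev]
    rcases hsq z hz with h | h
    · simp [h, hne z hz]
    · simp [h, (hne z hz).symm]
  · rcases hsq z hz with h | h
    · simp [h]
    · simp [Complex.exp_add, h, (hne z hz).symm, Complex.exp_pi_mul_I]

/-- The parity count behind the non-planarity of `K₃,₃`: each of the unknowns `n`, `n'`, `x`, `u`
occurs an even number of times in the sum of the eighteen equations with `i < k`, while
the contributions `w j l + w l j = 1` occur nine times. -/
lemma parity_contradiction (x u w : Fin 3 → Fin 3 → ℤ) (n n' : Fin 3 → Fin 3 → Fin 3 → ℤ)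
    (hu : ∀ i k, i ≠ k → u i k + u k i = 1) (hw : ∀ j l, j ≠ l → w j l + w l j = 1)
    (h : ∀ i j k l, i ≠ k → j ≠ l →
      ((1 - x k j) - u i k + 2 * n i j k) + (w l j - x k j + 2 * n' k l j) =
      (w j l - x i l + 2 * n' i j l) + ((1 - x i l) - u k i + 2 * n k l i)) : False := by
  have key : ∀ i j k l, i ≠ k → j ≠ l →
      - u i k + w l j - x k j + x i l + n i j k + n' k l j - n' i j l - n k l i = 0 := by
    intro i j k l hik hjl
    have h1 := h i j k l hik hjl
    have h2 := hu i k hik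
    have h3 := hw j l hjl
    omega
  have h01 := hw 0 1 (by decide)
  have h02 := hw 0 2 (by decide)
  have h12 := hw 1 2 (by decide)
  have e (i k : Fin 3) (hik : i ≠ k) :=
    And.intro (And.intro (key i 0 k 1 hik (by decide)) (key i 1 k 0 hik (by decide)))
     (And.intro (And.intro (key i 0 k 2 hik (by decide)) (key i 2 k 0 hik (by decide)))
      (And.intro (key i 1 k 2 hik (by decide)) (key i 2 k 1 hik (by decide))))
  obtain ⟨⟨a1, a2⟩, ⟨a3, a4⟩, a5, a6⟩ := e 0 1 (by decide)
  obtain ⟨⟨b1, b2⟩, ⟨b3, b4⟩, b5, b6⟩ := e 0 2 (by decide)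
  obtain ⟨⟨c1, c2⟩, ⟨c3, c4⟩, c5, c6⟩ := e 1 2 (by decide)
  omega

/-- `K₃,₃` has no weak drawing in the plane: there are no curves joining three points `a i` to
three points `b j` such that the curves for pairs with different first and different second ends
are disjoint. The curves may cross themselves, and curves with a common end may meet. -/
theorem not_exists_weak_drawing_K33 (a b : Fin 3 → ℂ) (γ : ∀ i j, Path (a i) (b j))
    (h : ∀ i j k l, i ≠ k → j ≠ l → ∀ s t, γ i j s ≠ γ k l t) : False := by
  obtain ⟨ℓ, p, hev, hp, hexp⟩ := exists_even_halfLog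
  let g (i j : Fin 3) : ℝ → ℂ := (γ i j).extend
  have hg (i j) : Continuous (g i j) := (γ i j).continuous_extend
  have g0 (i j) : g i j 0 = a i := (γ i j).extend_zero
  have g1 (i j) : g i j 1 = b j := (γ i j).extend_one
  have hdis (i j k l : Fin 3) (hik : i ≠ k) (hjl : j ≠ l) (s t : ℝ) : g i j s ≠ g k l t :=
    h i j k l hik hjl _ _
  have third (i k : Fin 3) : ∃ m : Fin 3, m ≠ i ∧ m ≠ k := by decide +revert
  have hga (i j k : Fin 3) (hik : i ≠ k) (s : ℝ) : g i j s - a k ≠ 0 := by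
    obtain ⟨l, hl, -⟩ := third j j
    rw [← g0 k l]
    exact sub_ne_zero.2 (hdis _ _ _ _ hik hl.symm _ _)
  have hgb (i j l : Fin 3) (hjl : j ≠ l) (s : ℝ) : g i j s - b l ≠ 0 := by
    obtain ⟨k, hk, -⟩ := third i i
    rw [← g1 k l]
    exact sub_ne_zero.2 (hdis _ _ _ _ hk.symm hjl _ _)
  have hint (f : ℝ → ℂ) (hf : Continuous f) (h0 : ∀ t, f t ≠ 0) : ∃ n : ℤ, logChange f =
      ℓ (f 1) - ℓ (f 0) + Real.pi * Complex.I * ((p (f 1) - p (f 0) + 2 * n : ℤ) : ℂ) := by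
    have h1 : Complex.exp (logChange f) = Complex.exp ((ℓ (f 1) + Real.pi * Complex.I * p (f 1)) -
        (ℓ (f 0) + Real.pi * Complex.I * p (f 0))) := by
      rw [exp_logChange hf h0, Complex.exp_sub, hexp _ (h0 1), hexp _ (h0 0)]
    obtain ⟨n, hn⟩ := Complex.exp_eq_exp_iff_exists_int.1 h1
    exact ⟨n, by rw [hn]; push_cast; ring⟩
  have hA (i j k : Fin 3) : ∃ n : ℤ, i ≠ k → logChange (fun s => g i j s - a k) =
      ℓ (b j - a k) - ℓ (a i - a k) +
        Real.pi * Complex.I * ((p (b j - a k) - p (a i - a k) + 2 * n : ℤ) : ℂ) := by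
    by_cases hik : i = k
    · exact ⟨0, fun h => absurd hik h⟩
    obtain ⟨n, hn⟩ := hint (fun s => g i j s - a k) ((hg i j).sub continuous_const) (hga i j k hik)
    exact ⟨n, fun _ => by simpa only [g0, g1] using hn⟩
  have hB (i j l : Fin 3) : ∃ n : ℤ, j ≠ l → logChange (fun s => g i j s - b l) =
      ℓ (b j - b l) - ℓ (a i - b l) +
        Real.pi * Complex.I * ((p (b j - b l) - p (a i - b l) + 2 * n : ℤ) : ℂ) := by
    by_cases hjl : j = l
    · exact ⟨0, fun h => absurd hjl h⟩
    obtain ⟨n, hn⟩ := hint (fun s => g i j s - b l) ((hg i j).sub continuous_const) (hgb i j l hjl)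
    exact ⟨n, fun _ => by simpa only [g0, g1] using hn⟩
  choose n hn using hA
  choose n' hn' using hB
  have haa (i k : Fin 3) (hik : i ≠ k) : a i - a k ≠ 0 := by
    rw [← g0 i 0]; exact hga i 0 k hik 0
  have hbb (j l : Fin 3) (hjl : j ≠ l) : b j - b l ≠ 0 := by
    rw [← g1 0 j]; exact hgb 0 j l hjl 1
  have hab (i j : Fin 3) : a i - b j ≠ 0 := by
    obtain ⟨l, hl, -⟩ := third j j
    rw [← g0 i l]; exact hgb i l j hl 0
  refine parity_contradiction (fun i j => p (a i - b j)) (fun i k => p (a i - a k))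
    (fun j l => p (b j - b l)) n n' (fun i k hik => ?_) (fun j l hjl => ?_)
    (fun i j k l hik hjl => ?_)
  · simpa using hp _ (haa i k hik)
  · simpa using hp _ (hbb j l hjl)
  · have hsq := logChange_square (hg i j) (hg k l) (hdis i j k l hik hjl)
    simp only [g0, g1] at hsq
    rw [hn i j k hik, hn' k l j hjl.symm, hn' i j l hjl, hn k l i hik.symm] at hsq
    have hsym (z z' : ℂ) : ℓ (z - z') = ℓ (z' - z) := by rw [← hev, neg_sub]
    have hpx (i j : Fin 3) : p (b j - a i) = 1 - p (a i - b j) := by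
      have := hp _ (hab i j)
      rw [neg_sub] at this
      omega
    rw [hsym (b j) (a k), hsym (b l) (a i), hsym (a k) (a i), hsym (b l) (b j),
      hpx, hpx] at hsq
    have hpi : (Real.pi * Complex.I : ℂ) ≠ 0 :=
      mul_ne_zero (by exact_mod_cast Real.pi_ne_zero) Complex.I_ne_zero
    have : ((((1 - p (a k - b j)) - p (a i - a k) + 2 * n i j k) +
        (p (b l - b j) - p (a k - b j) + 2 * n' k l j) : ℤ) : ℂ) =
        (((p (b j - b l) - p (a i - b l) + 2 * n' i j l) +
        ((1 - p (a i - b l)) - p (a k - a i) + 2 * n k l i) : ℤ) : ℂ) := by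
      apply mul_left_cancel₀ hpi
      push_cast at hsq ⊢
      linear_combination hsq
    exact_mod_cast this

namespace SimpleGraph

/-! ### Walks in a plane drawing -/

/-- Following the edges of a walk in a plane drawing gives a curve on the drawn walk. -/
lemma PlaneDrawing.exists_path_of_walk {W : Type*} {H : SimpleGraph W} (D : H.PlaneDrawing)
    {u v : W} (p : H.Walk u v) :
    ∃ γ : _root_.Path (D.point u) (D.point v), ∀ t,
      (∃ w ∈ p.support, γ t = D.point w) ∨ ∃ e ∈ p.edges, γ t ∈ D.arc e := by
  induction p with
  | nil => exact ⟨_root_.Path.refl _, fun t => Or.inl ⟨_, by simp, rfl⟩⟩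
  | @cons u v w h p ih =>
    obtain ⟨γ, hγ⟩ := ih
    obtain ⟨δ, -, hδ⟩ := D.exists_path u v h
    refine ⟨δ.trans γ, fun t => ?_⟩
    have ht : (δ.trans γ) t ∈ Set.range (δ.trans γ) := Set.mem_range_self t
    rw [_root_.Path.trans_range] at ht
    rcases ht with ht | ⟨s, hs⟩
    · exact Or.inr ⟨s(u, v), by simp, hδ ▸ ht⟩
    · rw [← hs]
      rcases hγ s with ⟨z, hz, h⟩ | ⟨e, he, h⟩
      · exact Or.inl ⟨z, by simp [hz], h⟩
      · exact Or.inr ⟨e, by simp [he], h⟩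

/-- A planar graph contains no `K₃,₃` whose edges are replaced by walks, where walks for edges
without a common end have no common vertex. -/
theorem IsPlanar.not_exists_K33_of_walks {W : Type*} {H : SimpleGraph W} (hH : H.IsPlanar)
    (a b : Fin 3 → W) (S : Fin 3 → Fin 3 → Set W)
    (hS : ∀ i j, ∃ p : H.Walk (a i) (b j), ∀ w ∈ p.support, w ∈ S i j)
    (hd : ∀ i j k l, i < k → j ≠ l → Disjoint (S i j) (S k l)) : False := by
  obtain ⟨D⟩ := hH
  choose p hp using hS
  choose γ hγ using fun i j => D.exists_path_of_walk (p i j)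
  let φ := Complex.equivRealProdCLM.symm
  have hmem {i j} {e : Sym2 W} (he : e ∈ (p i j).edges) {w : W} (hw : w ∈ e) : w ∈ S i j := by
    obtain ⟨z, rfl⟩ := hw
    exact hp i j _ ((p i j).fst_mem_support_of_mem_edges he)
  have key {i j k l} (hik : i < k) (hjl : j ≠ l) (s t) : γ i j s ≠ γ k l t := by
    intro h
    have hdis := Set.disjoint_left.1 (hd i j k l hik hjl)
    rcases hγ i j s with ⟨w, hw, hs⟩ | ⟨e, he, hs⟩ <;>
      rcases hγ k l t with ⟨z, hz, ht⟩ | ⟨f, hf, ht⟩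
    · have : w = z := D.point_injective (hs.symm.trans (h.trans ht))
      exact hdis (hp _ _ _ hw) (this ▸ hp _ _ _ hz)
    · have : w ∈ f := D.mem_of_point_mem_arc f (Walk.edges_subset_edgeSet _ hf) w
        (by rw [← hs, h]; exact ht)
      exact hdis (hp _ _ _ hw) (hmem hf this)
    · have : z ∈ e := D.mem_of_point_mem_arc e (Walk.edges_subset_edgeSet _ he) z
        (by rw [← ht, ← h]; exact hs)
      exact hdis (hmem he this) (hp _ _ _ hz)
    · have hef : e ≠ f := by
        rintro rfl
        induction e with
        | h x y => exact hdis (hmem he (Sym2.mem_mk_left x y)) (hmem hf (Sym2.mem_mk_left x y))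
      obtain ⟨w, hwe, hwf, -⟩ := D.arc_inter_arc e (Walk.edges_subset_edgeSet _ he) f
        (Walk.edges_subset_edgeSet _ hf) hef (γ i j s) ⟨hs, by rw [h]; exact ht⟩
      exact hdis (hmem he hwe) (hmem hf hwf)
  refine not_exists_weak_drawing_K33 (fun i => φ (D.point (a i))) (fun j => φ (D.point (b j)))
    (fun i j => (γ i j).map φ.continuous) (fun i j k l hik hjl s t h => ?_)
  have h' : γ i j s = γ k l t := φ.injective (by simpa using h)
  rcases lt_or_gt_of_ne hik with hik | hik
  · exact key hik hjl s t h'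
  · exact key hik hjl.symm t s h'.symm

/-! ### Walks in the great shadow -/

variable {V : Type*} {G : SimpleGraph V}

@[simp] lemma greatShadow_adj_inl_inl {u v : V} :
    G.greatShadow.Adj (.inl u) (.inl v) ↔ G.Adj u v := Iff.rfl

@[simp] lemma greatShadow_adj_inl_inr {u v : V} :
    G.greatShadow.Adj (.inl u) (.inr v) ↔ u = v ∨ G.Adj u v := Iff.rfl

@[simp] lemma greatShadow_adj_inr_inl {u v : V} :
    G.greatShadow.Adj (.inr u) (.inl v) ↔ u = v ∨ G.Adj u v := Iff.rfl

@[simp] lemma greatShadow_not_adj_inr_inr {u v : V} :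
    ¬ G.greatShadow.Adj (.inr u) (.inr v) := id

/-- The vertex of `G` from which a vertex of the great shadow is copied. -/
abbrev shadowBase : V ⊕ V → V := Sum.elim id id

/-- A path has two disjoint lifts to the great shadow that alternate between original vertices and
shadow vertices. -/
lemma Walk.IsPath.exists_alternating_lifts {u w : V} {q : G.Walk u w} (hq : q.IsPath) :
    (Even q.length → ∃ (p : G.greatShadow.Walk (.inl u) (.inl w))
      (p' : G.greatShadow.Walk (.inr u) (.inr w)), p.support.Disjoint p'.support ∧
        (∀ z ∈ p.support, shadowBase z ∈ q.support) ∧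
        ∀ z ∈ p'.support, shadowBase z ∈ q.support) ∧
    (Odd q.length → ∃ (p : G.greatShadow.Walk (.inl u) (.inr w))
      (p' : G.greatShadow.Walk (.inr u) (.inl w)), p.support.Disjoint p'.support ∧
        (∀ z ∈ p.support, shadowBase z ∈ q.support) ∧
        ∀ z ∈ p'.support, shadowBase z ∈ q.support) := by
  induction q with
  | nil => exact ⟨fun _ => ⟨.nil, .nil, by simp, by simp, by simp⟩, by simp⟩
  | @cons u v w h q ih =>
    obtain ⟨hq, hu⟩ := (Walk.cons_isPath_iff h q).1 hq
    obtain ⟨ih1, ih2⟩ := ih hq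
    have h1 : G.greatShadow.Adj (.inl u) (.inr v) := Or.inr h
    have h2 : G.greatShadow.Adj (.inr u) (.inl v) := Or.inr h
    constructor
    · intro hl
      obtain ⟨p, p', hd, hp, hp'⟩ := ih2 (by
        rw [Walk.length_cons] at hl
        exact (Nat.not_even_iff_odd.1 fun h => (Nat.even_add_one.1 hl) h))
      have hpu : Sum.inr u ∉ p'.support := fun h => hu (hp' _ h)
      have hpu' : Sum.inl u ∉ p.support := fun h => hu (hp _ h)
      refine ⟨.cons h1 p', .cons h2 p, ?_, ?_, ?_⟩
      · simp [hpu, hpu', hd.symm]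
      · simpa using ⟨fun a ha => Or.inr (hp' _ ha), fun a ha => Or.inr (hp' _ ha)⟩
      · simpa using ⟨fun a ha => Or.inr (hp _ ha), fun a ha => Or.inr (hp _ ha)⟩
    · intro hl
      obtain ⟨p, p', hd, hp, hp'⟩ := ih1 (by
        rw [Walk.length_cons] at hl
        exact (Nat.not_odd_iff_even.1 fun h => (Nat.odd_add_one.1 hl) h))
      have hpu : Sum.inr u ∉ p'.support := fun h => hu (hp' _ h)
      have hpu' : Sum.inl u ∉ p.support := fun h => hu (hp _ h)
      refine ⟨.cons h1 p', .cons h2 p, ?_, ?_, ?_⟩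
      · simp [hpu, hpu', hd.symm]
      · simpa using ⟨fun a ha => Or.inr (hp' _ ha), fun a ha => Or.inr (hp' _ ha)⟩
      · simpa using ⟨fun a ha => Or.inr (hp _ ha), fun a ha => Or.inr (hp _ ha)⟩

/-- A walk of `G` may be followed from the shadow of its first vertex. -/
lemma Walk.exists_walk_from_shadow {y t : V} (q : G.Walk y t) :
    ∃ p : G.greatShadow.Walk (.inr y) (.inl t), ∀ w ∈ p.support,
      w = .inr y ∨ ∃ z, (z ∈ q.support.tail ∨ z = t) ∧ w = .inl z := by
  cases q with
  | nil => exact ⟨.cons (greatShadow_adj_inr_inl.2 (Or.inl rfl)) .nil, by simp⟩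
  | @cons _ v _ h r =>
    let φ : G →g G.greatShadow := ⟨Sum.inl, fun h => h⟩
    refine ⟨.cons (greatShadow_adj_inr_inl.2 (Or.inr h)) (r.map φ), ?_⟩
    intro w hw
    rw [Walk.support_cons, List.mem_cons, Walk.support_map, List.mem_map] at hw
    rcases hw with rfl | ⟨z, hz, rfl⟩
    · exact Or.inl rfl
    · exact Or.inr ⟨z, Or.inl (by simpa using hz), rfl⟩

/-! ### Odd cycles -/

lemma Walk.exists_odd_isCycle {u : V} (w : G.Walk u u) (hw : Odd w.length) :
    ∃ (v : V) (c : G.Walk v v), c.IsCycle ∧ Odd c.length := by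
  induction hn : w.length using Nat.strong_induction_on generalizing u with
  | _ n ih =>
  subst hn
  cases w with
  | nil => simp at hw
  | @cons _ v _ h p =>
    by_cases hp : p.IsPath
    · refine ⟨u, .cons h p, (Walk.cons_isCycle_iff p h).2 ⟨hp, fun he => ?_⟩, hw⟩
      rw [Sym2.eq_swap] at he
      have := hp.length_eq_one_of_mem_edges he
      simp [this] at hw
      exact absurd hw (by decide)
    · rw [Walk.isPath_iff_isSubwalk_imp_nil] at hp
      push Not at hp
      obtain ⟨x, r, ⟨r₁, r₂, rfl⟩, hr⟩ := hp
      rw [← Walk.length_eq_zero_iff] at hr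
      simp only [Walk.length_cons, Walk.length_append] at hw ih
      by_cases hro : Odd r.length
      · exact ih _ (by omega) r hro rfl
      · refine ih _ ?_ (.cons h (r₁.append r₂)) ?_ rfl <;>
          simp only [Walk.length_cons, Walk.length_append]
        · omega
        · grind

/-- The `K₃,₃` in the great shadow of an odd cycle: its parts are the original vertices and the
shadow vertices of three consecutive vertices `a`, `v`, `c`. The two missing edges are the two
alternating lifts of the rest of the cycle. -/
lemma not_isPlanar_of_odd_path {v a c : V} (hva : G.Adj v a) (hvc : G.Adj v c) {q : G.Walk c a}
    (hq : q.IsPath) (hv : v ∉ q.support) (hodd : Odd q.length) : ¬ G.greatShadow.IsPlanar := by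
  intro hS
  obtain ⟨p, p', hd, hp, hp'⟩ := hq.exists_alternating_lifts.2 hodd
  have hd' : ∀ {z}, z ∈ p.support → z ∉ p'.support := fun h h' => hd h h'
  have hlc : Sum.inl c ∉ p'.support := hd' p.start_mem_support
  have hra : Sum.inr a ∉ p'.support := hd' p.end_mem_support
  have hrc : Sum.inr c ∉ p.support := fun h => hd' h p'.start_mem_support
  have hla : Sum.inl a ∉ p.support := fun h => hd' h p'.end_mem_support
  have hlv : Sum.inl v ∉ p.support := fun h => hv (hp _ h)
  have hrv : Sum.inr v ∉ p.support := fun h => hv (hp _ h)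
  have hlv' : Sum.inl v ∉ p'.support := fun h => hv (hp' _ h)
  have hrv' : Sum.inr v ∉ p'.support := fun h => hv (hp' _ h)
  have hac : a ≠ c := by
    rintro rfl
    rw [Walk.length_eq_zero_iff.2 (Walk.isPath_iff_nil.1 hq)] at hodd
    simp at hodd
  have hav := hva.ne'
  have hcv := hvc.ne'
  refine hS.not_exists_K33_of_walks ![.inl c, .inl a, .inl v] ![.inr a, .inr c, .inr v]
    ![![{z | z ∈ p.support}, {.inl c, .inr c}, {.inl c, .inr v}],
      ![{.inl a, .inr a}, {z | z ∈ p'.support}, {.inl a, .inr v}],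
      ![{.inl v, .inr a}, {.inl v, .inr c}, {.inl v, .inr v}]] ?_ ?_
  · have edge {x y : V ⊕ V} (h : G.greatShadow.Adj x y) :
        ∃ r : G.greatShadow.Walk x y, ∀ w ∈ r.support, w ∈ ({x, y} : Set (V ⊕ V)) :=
      ⟨h.toWalk, by simp⟩
    simp only [Fin.forall_fin_succ, IsEmpty.forall_iff, and_true]
    refine ⟨⟨⟨p, fun w h => h⟩, edge (Or.inl rfl), edge (Or.inr hvc.symm)⟩,
      ⟨edge (Or.inl rfl), ⟨p'.reverse, fun w h => ?_⟩, edge (Or.inr hva.symm)⟩,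
      edge (Or.inr hva), edge (Or.inr hvc), edge (Or.inl rfl)⟩
    simpa using h
  · intro i j k l hik hjl
    rw [Set.disjoint_left]
    fin_cases i <;> fin_cases k <;> first | exact absurd hik (by decide) | skip
    all_goals
      fin_cases j <;> fin_cases l <;> first | exact absurd rfl hjl | skip
    all_goals
      simp_all [hac.symm, hav.symm, hcv.symm]
    all_goals
      refine ⟨by rintro x hx rfl; contradiction, ?_⟩
      rintro x hx rfl
      first | contradiction | exact hd'.2 _ p.end_mem_support hx

theorem isBipartite_of_isPlanar_greatShadow (hS : G.greatShadow.IsPlanar) : G.IsBipartite := by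
  refine two_colorable_iff_forall_loop_even.2 fun u w => ?_
  by_contra hw
  obtain ⟨v, c, hc, hodd⟩ := w.exists_odd_isCycle (Nat.not_even_iff_odd.1 hw)
  cases c with
  | nil => simp at hodd
  | @cons _ a _ h p =>
    obtain ⟨hp, he⟩ := (Walk.cons_isCycle_iff p h).1 hc
    cases p with
    | nil => exact h.ne rfl
    | @cons _ b _ h' q =>
      obtain ⟨hq, ha⟩ := (Walk.cons_isPath_iff h' q).1 hp
      refine not_isPlanar_of_odd_path h.symm h' hq ha ?_ hS
      simp only [Walk.length_cons] at hodd
      grind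

end SimpleGraph

namespace SimpleGraph

variable {V : Type*} {G : SimpleGraph V}

/-! ### Three neighbours in one component of a vertex-deleted subgraph -/

/-- The vertices `a` and `b` are joined by a walk that does not visit `x`. -/
def JoinedAvoiding (G : SimpleGraph V) (x a b : V) : Prop :=
  ∃ p : G.Walk a b, x ∉ p.support

lemma JoinedAvoiding.symm {x a b : V} : G.JoinedAvoiding x a b → G.JoinedAvoiding x b a :=
  fun ⟨p, hp⟩ => ⟨p.reverse, by simpa using hp⟩

lemma JoinedAvoiding.trans {x a b c : V} :
    G.JoinedAvoiding x a b → G.JoinedAvoiding x b c → G.JoinedAvoiding x a c :=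
  fun ⟨p, hp⟩ ⟨q, hq⟩ => ⟨p.append q, by simp [Walk.mem_support_append_iff, hp, hq]⟩

lemma JoinedAvoiding.refl {x a : V} (h : x ≠ a) : G.JoinedAvoiding x a a := ⟨.nil, by simpa⟩

lemma Adj.joinedAvoiding {x a b : V} (h : G.Adj a b) (ha : x ≠ a) (hb : x ≠ b) :
    G.JoinedAvoiding x a b := ⟨h.toWalk, by simp [ha, hb]⟩

lemma JoinedAvoiding.exists_isPath {x a b : V} (h : G.JoinedAvoiding x a b) :
    ∃ p : G.Walk a b, p.IsPath ∧ x ∉ p.support := by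
  classical
  obtain ⟨p, hp⟩ := h
  exact ⟨p.bypass, p.bypass_isPath, fun h => hp (p.support_bypass_subset_support h)⟩

/-- Some three neighbours of one vertex `x` lie in the same component of `G - x`. This holds if
and only if two distinct cycles share an edge. -/
def HasTripleBranch (G : SimpleGraph V) : Prop :=
  ∃ (x : V) (t : Fin 3 → V), Function.Injective t ∧ (∀ i, G.Adj x (t i)) ∧
    ∀ i j, G.JoinedAvoiding x (t i) (t j)

/-- A walk that ends in a set `X` has an initial part that ends at its first vertex in `X`; the part
is given in reversed direction. -/
lemma Walk.exists_walk_from_first_mem {c d : V} (q : G.Walk c d) {X : Set V} (hd : d ∈ X) :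
    ∃ y ∈ X, y ∈ q.support ∧ ∃ r : G.Walk y c,
      ∀ z ∈ r.support.tail, z ∉ X ∧ z ∈ q.support := by
  induction q with
  | nil => exact ⟨_, hd, by simp, .nil, by simp⟩
  | @cons c c' d h q ih =>
    by_cases hc : c ∈ X
    · exact ⟨c, hc, by simp, .nil, by simp⟩
    · obtain ⟨y, hy, hyq, r, hr⟩ := ih hd
      refine ⟨y, hy, by simp [hyq], r.concat h.symm, fun z hz => ?_⟩
      rw [Walk.support_concat, List.tail_append_of_ne_nil (by simp)] at hz
      rcases List.mem_append.1 hz with hz | hz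
      · exact ⟨(hr z hz).1, by simp [(hr z hz).2]⟩
      · obtain rfl : z = c := by simpa using hz
        exact ⟨hc, by simp⟩

/-- A tripod that avoids `x`: three walks from a common vertex `y` to the vertices `t j`, each of
which does not meet the other two of them after its start. (The vertex `y` may be one of
them.) -/
lemma exists_tripod {x : V} {t : Fin 3 → V} (ht : Function.Injective t)
    (h : ∀ i j, G.JoinedAvoiding x (t i) (t j)) :
    ∃ y, y ≠ x ∧ ∀ j, ∃ q : G.Walk y (t j), ∀ z ∈ q.support.tail, z ≠ x ∧ ∀ k ≠ j, z ≠ t k := by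
  classical
  obtain ⟨P, hP, hPx⟩ := (h 0 1).exists_isPath
  obtain ⟨Q, hQx⟩ := h 2 0
  obtain ⟨y, hy, hyQ, R, hR⟩ := Q.exists_walk_from_first_mem (X := {z | z ∈ P.support})
    P.start_mem_support
  have hyP : y ∈ P.support := hy
  have ht01 : t 0 ≠ t 1 := ht.ne (by decide)
  -- if `t 2` lies on `P`, it is the first vertex on `P`, so that `y = t 2`
  have h2 : t 2 ∈ P.support → y = t 2 := by
    intro h2
    by_contra hne
    exact (hR _ (Walk.end_mem_tail_support_of_ne hne R)).1 h2
  have side {u v : V} (p : G.Walk u v) (hp : p.IsPath) (hpy : y ∈ p.support) (huv : u ≠ v)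
      (hpP : ∀ z ∈ p.support, z ∈ P.support) : ∃ q : G.Walk y u, ∀ z ∈ q.support.tail,
        z ≠ x ∧ z ≠ v ∧ z ≠ t 2 := by
    refine ⟨(p.takeUntil y hpy).reverse, fun z hz => ?_⟩
    have hzp : z ∈ (p.takeUntil y hpy).support := by
      simpa using List.mem_of_mem_tail hz
    have hzP : z ∈ P.support := hpP z (p.support_takeUntil_subset_support hpy hzp)
    have hzy : z ≠ y := by
      have hn := ((hp.takeUntil hpy).reverse).support_nodup
      rw [← Walk.cons_tail_support, List.nodup_cons] at hn
      rintro rfl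
      exact hn.1 hz
    refine ⟨fun h => hPx (h ▸ hzP), ?_, fun h => hzy (h.trans (h2 (h ▸ hzP)).symm)⟩
    rintro rfl
    exact Walk.endpoint_notMem_support_takeUntil hp hpy hzy hzp
  refine ⟨y, fun h => hPx (h ▸ hyP), ?_⟩
  obtain ⟨q0, hq0⟩ := side P hP hyP ht01 (fun z h => h)
  obtain ⟨q1, hq1⟩ := side P.reverse hP.reverse (by simpa using hyP) ht01.symm (by simp)
  simp only [Fin.forall_fin_succ, IsEmpty.forall_iff, and_true]
  refine ⟨⟨q0, fun z hz => ⟨(hq0 z hz).1, by simp, fun _ => (hq0 z hz).2.1,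
      fun _ => (hq0 z hz).2.2⟩⟩, ⟨q1, fun z hz => ⟨(hq1 z hz).1, fun _ => (hq1 z hz).2.1, by simp,
      fun _ => (hq1 z hz).2.2⟩⟩, ⟨R, fun z hz => ⟨?_, fun _ => ?_, fun _ => ?_, by simp⟩⟩⟩
  · rintro rfl; exact hQx (hR _ hz).2
  · rintro rfl; exact (hR _ hz).1 P.start_mem_support
  · rintro rfl; exact (hR _ hz).1 P.end_mem_support

/-- If three neighbours `t j` of `x` lie in one component of `G - x`, then `x`, its shadow, and the
shadow of the centre of a tripod are the first part of a `K₃,₃` with second part `t`. -/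
theorem HasTripleBranch.not_isPlanar (h : G.HasTripleBranch) : ¬ G.greatShadow.IsPlanar := by
  intro hS
  obtain ⟨x, t, ht, hxt, hj⟩ := h
  obtain ⟨y, hyx, hy⟩ := exists_tripod ht hj
  choose q hq using hy
  refine hS.not_exists_K33_of_walks ![.inl x, .inr x, .inr y] (fun j => .inl (t j))
    ![fun j => {.inl x, .inl (t j)}, fun j => {.inr x, .inl (t j)},
      fun j => {w | w = .inr y ∨ ∃ z, (z ∈ (q j).support.tail ∨ z = t j) ∧ w = .inl z}] ?_ ?_
  · have edge {x y : V ⊕ V} (h : G.greatShadow.Adj x y) :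
        ∃ r : G.greatShadow.Walk x y, ∀ w ∈ r.support, w ∈ ({x, y} : Set (V ⊕ V)) :=
      ⟨h.toWalk, by simp⟩
    intro i j
    fin_cases i
    · exact edge (hxt j)
    · exact edge (Or.inr (hxt j))
    · exact (q j).exists_walk_from_shadow
  · intro i j k l hik hjl
    have hne : t j ≠ t l := ht.ne hjl
    have hx (j) : t j ≠ x := (hxt j).ne'
    rw [Set.disjoint_left]
    fin_cases i <;> fin_cases k <;> first | exact absurd hik (by decide) | skip
    · simp [hne, (hx l).symm]
    · simpa [hne, (hx l).symm] using
        ⟨fun z h => (hq l z h).1.symm, fun z h => ((hq l z h).2 j hjl).symm⟩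
    · simpa [hne, hyx.symm] using fun z h => ((hq l z h).2 j hjl).symm

/-! ### Cycles that share an edge -/

/-- Two paths with the same ends that continue a common walk part ways at some vertex, which then
has three neighbours that are joined by walks avoiding it. -/
lemma hasTripleBranch_of_isPath_of_ne {w v u : V} (hwv : G.Adj w v) {p q : G.Walk v u}
    (hp : p.IsPath) (hq : q.IsPath) (hpq : p ≠ q) (hwp : s(w, v) ∉ p.edges)
    (hwq : s(w, v) ∉ q.edges) (r : G.Walk w u)
    (hr : ∀ z ∈ r.support, z ≠ u → z ∉ p.support ∧ z ∉ q.support) : G.HasTripleBranch := by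
  induction p generalizing w with
  | nil => exact absurd (Walk.eq_nil_iff_nil.2 (Walk.isPath_iff_nil.1 hq)).symm hpq
  | @cons v a u h p ih =>
    obtain ⟨hp, hv⟩ := (Walk.cons_isPath_iff h p).1 hp
    have hvu : v ≠ u := by rintro rfl; exact hv p.end_mem_support
    cases q with
    | nil => exact absurd rfl hvu
    | @cons _ b _ h' q =>
      obtain ⟨hq, hv'⟩ := (Walk.cons_isPath_iff h' q).1 hq
      have hvr : v ∉ r.support := fun h => (hr v h hvu).1 (by simp)
      by_cases hab : a = b
      · subst hab
        refine ih h hp hq (fun h => hpq (by rw [h])) (fun h => hv (p.fst_mem_support_of_mem_edges h))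
          (fun h => hv' (q.fst_mem_support_of_mem_edges h)) (.cons hwv.symm r) ?_
        intro z hz hzu
        rw [Walk.support_cons, List.mem_cons] at hz
        rcases hz with rfl | hz
        · exact ⟨hv, hv'⟩
        · have := hr z hz hzu
          simp only [Walk.support_cons, List.mem_cons, not_or] at this
          exact ⟨this.1.2, this.2.2⟩
      · have hwa : w ≠ a := by rintro rfl; exact hwp (by simp [Sym2.eq_swap])
        have hwb : w ≠ b := by rintro rfl; exact hwq (by simp [Sym2.eq_swap])
        have key : ∀ i, G.JoinedAvoiding v (![w, a, b] i) u := by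
          intro i
          fin_cases i
          exacts [⟨r, hvr⟩, ⟨p, hv⟩, ⟨q, hv'⟩]
        refine ⟨v, ![w, a, b], ?_, ?_, fun i j => (key i).trans (key j).symm⟩
        · intro i j hij
          fin_cases i <;> fin_cases j <;> simp_all [eq_comm]
        · intro i
          fin_cases i
          exacts [hwv.symm, h, h']

/-- A cycle through the edge `uv` can be rotated and reversed so that it starts with the step from
`u` to `v`. -/
lemma Walk.IsCycle.exists_isCycle_cons {x u v : V} {c : G.Walk x x} (hc : c.IsCycle)
    (he : s(u, v) ∈ c.edges) : ∃ (h : G.Adj u v) (p : G.Walk v u),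
      (Walk.cons h p).IsCycle ∧ (Walk.cons h p).toSubgraph = c.toSubgraph := by
  classical
  have hu : u ∈ c.support := c.fst_mem_support_of_mem_edges he
  have hcyc : (c.rotate u hu).IsCycle := hc.rotate hu
  have hsub : (c.rotate u hu).toSubgraph = c.toSubgraph := c.toSubgraph_rotate hu
  have he' : s(u, v) ∈ (c.rotate u hu).edges := (c.rotate_edges u hu).mem_iff.2 he
  generalize c.rotate u hu = d at hcyc hsub he'
  have first {d : G.Walk u u} (hd : d.IsCycle) (hsub : d.toSubgraph = c.toSubgraph)
      (hv : d.snd = v) : ∃ (h : G.Adj u v) (p : G.Walk v u),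
      (Walk.cons h p).IsCycle ∧ (Walk.cons h p).toSubgraph = c.toSubgraph := by
    cases d with
    | nil => exact absurd hd (by simp)
    | cons h p =>
      rw [Walk.snd_cons] at hv
      subst hv
      exact ⟨h, p, hd, hsub⟩
  by_cases hv : d.snd = v
  · exact first hcyc hsub hv
  · refine first hcyc.reverse (by rw [Walk.toSubgraph_reverse, hsub]) ?_
    rw [Walk.snd_reverse]
    cases d with
    | nil => exact absurd hcyc (by simp)
    | @cons _ b _ h p =>
      rw [Walk.snd_cons] at hv
      have hp := ((Walk.cons_isCycle_iff p h).1 hcyc).1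
      rw [Walk.edges_cons, List.mem_cons] at he'
      rcases he' with he' | he'
      · exact absurd (Sym2.congr_right.1 he').symm hv
      · have hnil : ¬ p.Nil := fun hn => by rw [Walk.edges_eq_nil.2 hn] at he'; simp at he'
        rw [Walk.penultimate_cons_of_not_nil _ _ hnil]
        exact (hp.eq_penultimate_of_mem_edges he').symm

lemma hasTripleBranch_of_isCycle_of_ne {u v : V} {p : G.Walk u u} {q : G.Walk v v}
    (hp : p.IsCycle) (hq : q.IsCycle) (hne : p.toSubgraph ≠ q.toSubgraph) {e : Sym2 V}
    (hep : e ∈ p.edges) (heq : e ∈ q.edges) : G.HasTripleBranch := by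
  induction e with
  | h a b =>
    obtain ⟨h, p', hp', hps⟩ := hp.exists_isCycle_cons hep
    obtain ⟨_, q', hq', hqs⟩ := hq.exists_isCycle_cons heq
    obtain ⟨hp1, hp2⟩ := (Walk.cons_isCycle_iff p' h).1 hp'
    obtain ⟨hq1, hq2⟩ := (Walk.cons_isCycle_iff q' h).1 hq'
    refine hasTripleBranch_of_isPath_of_ne h hp1 hq1 ?_ hp2 hq2 .nil (by simp)
    rintro rfl
    exact hne (hps.symm.trans hqs)

/-- If `a`, `b`, `c` are neighbours of `x` in one component of `G - x`, then `xa` lies on a cycle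
through `b` and `x`, and on a cycle through `c` and `x`, and only the latter contains `xc`. -/
theorem IsCactus.not_hasTripleBranch (hG : G.IsCactus) : ¬ G.HasTripleBranch := by
  rintro ⟨x, t, ht, hxt, hj⟩
  have cyc (j : Fin 3) (hj0 : j ≠ 0) : ∃ c : G.Walk x x, c.IsCycle ∧
      ∀ w, s(x, w) ∈ c.edges ↔ w = t 0 ∨ w = t j := by
    obtain ⟨p, hp, hpx⟩ := (hj 0 j).exists_isPath
    have hx (w) : s(x, w) ∉ p.edges := fun h => hpx (p.fst_mem_support_of_mem_edges h)
    have h0j : t 0 ≠ t j := ht.ne hj0.symm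
    have hxj : x ≠ t j := (hxt j).ne
    refine ⟨.cons (hxt 0) (p.concat (hxt j).symm), (Walk.cons_isCycle_iff _ _).2 ⟨?_, ?_⟩, ?_⟩
    · exact hp.concat hpx _
    · simp [Walk.edges_concat, hx, h0j, hxj]
    · intro w
      simp [Walk.edges_concat, hx, hxj, (hxt 0).ne, eq_comm]
  obtain ⟨c, hc, hcx⟩ := cyc 1 (by decide)
  obtain ⟨d, hd, hdx⟩ := cyc 2 (by decide)
  refine hG.2 x x c d hc hd (fun h => ?_) s(x, t 0) ⟨(hcx _).2 (Or.inl rfl), (hdx _).2 (Or.inl rfl)⟩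
  have h2 : s(x, t 2) ∈ c.edges := by
    rw [← Walk.mem_edges_toSubgraph, h, Walk.mem_edges_toSubgraph]
    exact (hdx _).2 (Or.inr rfl)
  rcases (hcx _).1 h2 with h | h
  · exact absurd (ht h) (by decide)
  · exact absurd (ht h) (by decide)

theorem isCactus_of_isPlanar_greatShadow (hG : G.Connected) (hS : G.greatShadow.IsPlanar) :
    G.IsCactus :=
  ⟨hG, fun _ _ _ _ hp hq hne _ he =>
    (hasTripleBranch_of_isCycle_of_ne hp hq hne he.1 he.2).not_isPlanar hS⟩

end SimpleGraph

namespace SimpleGraph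

variable {V : Type*} {G : SimpleGraph V}

/-! ### An end block of a graph without triple branches -/

lemma Connected.mem_of_adj_closed (hG : G.Connected) {S : Set V} {x : V} (hx : x ∈ S)
    (hS : ∀ u ∈ S, ∀ v, G.Adj u v → v ∈ S) (v : V) : v ∈ S := by
  obtain ⟨p⟩ := hG.preconnected x v
  induction p with
  | nil => exact hx
  | cons h p ih => exact ih (hS _ hx _ h)

/-- `K` is a nonempty set of vertices whose only neighbour outside `K` is, if any, the vertex `x`. -/
structure IsBranchAt (G : SimpleGraph V) (x : V) (K : Set V) : Prop where
  notMem : x ∉ K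
  nonempty : K.Nonempty
  adj : ∀ u ∈ K, ∀ v, G.Adj u v → v ∈ K ∨ v = x

/-- A vertex `c` of a smallest branch is not a cut vertex: a component of `G - c` that does not
contain the root of the branch would be a smaller branch. -/
lemma IsBranchAt.joinedAvoiding_of_minimal [Finite V] (hG : G.Connected) {x : V} {K : Set V}
    (hK : G.IsBranchAt x K) (hmin : ∀ y L, G.IsBranchAt y L → K.ncard ≤ L.ncard) {c v : V}
    (hc : c ∈ K) (hv : v ≠ c) : G.JoinedAvoiding c x v := by
  let R : Set V := {v | v ≠ c ∧ ¬ G.JoinedAvoiding c x v}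
  have hcx : c ≠ x := fun h => hK.notMem (h ▸ hc)
  have hxR : x ∉ R := fun h => h.2 (.refl hcx)
  have hR : ∀ u ∈ R, ∀ w, G.Adj u w → w ∈ R ∨ w = c := by
    intro u hu w huw
    by_contra! h
    have : G.JoinedAvoiding c x w := by
      by_contra hw
      exact h.1 ⟨h.2, hw⟩
    exact hu.2 (this.trans (huw.symm.joinedAvoiding h.2.symm hu.1.symm))
  have hRK : ∀ u ∈ R, u ∉ K := by
    intro u huR huK
    have hbr : G.IsBranchAt c (R ∩ K) := by
      refine ⟨fun h => h.1.1 rfl, ⟨u, huR, huK⟩, fun u hu w huw => ?_⟩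
      rcases hR u hu.1 w huw with hw | hw
      · rcases hK.adj u hu.2 w huw with hw' | rfl
        · exact Or.inl ⟨hw, hw'⟩
        · exact absurd hw hxR
      · exact Or.inr hw
    have hlt : (R ∩ K).ncard < K.ncard :=
      Set.ncard_lt_ncard ⟨Set.inter_subset_right, fun h => (h hc).1.1 rfl⟩
    exact absurd (hmin c _ hbr) (not_le.2 hlt)
  by_contra hnot
  refine hxR (hG.mem_of_adj_closed (S := R) (x := v) ⟨hv, hnot⟩ (fun u hu w huw => ?_) x)
  rcases hR u hu w huw with hw | rfl
  · exact hw
  · rcases hK.adj w hc u huw.symm with h | rfl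
    · exact absurd h (hRK u hu)
    · exact absurd hu hxR

/-- A connected graph without a triple branch has an end block that is an edge or a cycle: a path
`q` whose ends `x` and `b` are adjacent, without any other chords, and such that only `x` has
neighbours outside the path. It comes from a smallest branch, whose vertices have degree at most
two. -/
theorem exists_end_block [Finite V] [Nontrivial V] (hG : G.Connected) (hT : ¬ G.HasTripleBranch) :
    ∃ (x b : V) (q : G.Walk x b), q.IsPath ∧ G.Adj x b ∧
      (∀ u ∈ q.support, u ≠ x → ∀ v, G.Adj u v → v ∈ q.support) ∧
      ∀ i j, i < j → j ≤ q.length → G.Adj (q.getVert i) (q.getVert j) →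
        j = i + 1 ∨ i = 0 ∧ j = q.length := by
  classical
  obtain ⟨x, K, hK, hmin⟩ : ∃ x K, G.IsBranchAt x K ∧
      ∀ y L, G.IsBranchAt y L → K.ncard ≤ L.ncard := by
    have hex : ∃ n x K, G.IsBranchAt x K ∧ K.ncard = n := by
      obtain ⟨x, y, hxy⟩ := exists_pair_ne V
      exact ⟨_, x, {x}ᶜ, ⟨by simp, ⟨y, hxy.symm⟩, fun u _ v _ => (em (v = x)).symm⟩, rfl⟩
    obtain ⟨x, K, hK, hn⟩ := Nat.find_spec hex
    exact ⟨x, K, hK, fun y L hL => hn ▸ Nat.find_min' hex ⟨y, L, hL, rfl⟩⟩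
  have hdeg {c a b d : V} (hc : c ∈ K) (ha : G.Adj c a) (hb : G.Adj c b) (hd : G.Adj c d)
      (hab : a ≠ b) : d = a ∨ d = b := by
    by_contra! h
    have hj {v : V} (hv : G.Adj c v) : G.JoinedAvoiding c x v :=
      hK.joinedAvoiding_of_minimal hG hmin hc hv.ne'
    have key : ∀ i, G.Adj c (![a, b, d] i) := by
      intro i
      fin_cases i
      exacts [ha, hb, hd]
    refine hT ⟨c, ![a, b, d], ?_, key, fun i j => (hj (key i)).symm.trans (hj (key j))⟩
    intro i j hij
    fin_cases i <;> fin_cases j <;> simp_all [eq_comm]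
  -- a longest path from `x` into the branch
  obtain ⟨b, q, hq, hqK, hmax⟩ : ∃ b, ∃ q : G.Walk x b, q.IsPath ∧
      (∀ u ∈ q.support, u ≠ x → u ∈ K) ∧ ∀ b', ∀ q' : G.Walk x b', q'.IsPath →
        (∀ u ∈ q'.support, u ≠ x → u ∈ K) → q'.length ≤ q.length := by
    have := Fintype.ofFinite V
    let P : ℕ → Prop := fun n => ∃ b, ∃ q : G.Walk x b, q.IsPath ∧
      (∀ u ∈ q.support, u ≠ x → u ∈ K) ∧ q.length = n
    have h0 : P 0 := ⟨x, .nil, by simp, by simp, rfl⟩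
    obtain ⟨b, q, hq, hqK, hn⟩ := Nat.findGreatest_spec (P := P) (Nat.zero_le (Fintype.card V)) h0
    exact ⟨b, q, hq, hqK, fun b' q' hq' hqK' => hn ▸
      Nat.le_findGreatest (P := P) hq'.length_lt.le ⟨b', q', hq', hqK', rfl⟩⟩
  have hlast : ∀ u, b ∈ K → G.Adj b u → u ∈ q.support := by
    intro u hb hbu
    by_contra hu
    have := hmax u (q.concat hbu) (hq.concat hu hbu) (fun z hz hzx => by
      rw [Walk.support_concat, List.mem_append, List.mem_singleton] at hz
      rcases hz with hz | rfl
      · exact hqK z hz hzx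
      · exact (hK.adj b hb z hbu).resolve_right hzx)
    simp at this
  have hinj {i j : ℕ} (hi : i ≤ q.length) (hj : j ≤ q.length)
      (h : q.getVert i = q.getVert j) : i = j := hq.getVert_injOn hi hj h
  have hmem {i : ℕ} (hi : i ≤ q.length) (h0 : 0 < i) : q.getVert i ∈ K :=
    hqK _ (q.getVert_mem_support i) (fun h => h0.ne' (hinj hi (Nat.zero_le _) (by simpa using h)))
  have hmid {i : ℕ} {u : V} (h0 : 0 < i) (hi : i < q.length) (hu : G.Adj (q.getVert i) u) :
      u = q.getVert (i - 1) ∨ u = q.getVert (i + 1) := by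
    have h1 := q.adj_getVert_succ (i := i - 1) (by omega)
    rw [Nat.sub_add_cancel h0] at h1
    refine hdeg (hmem hi.le h0) h1.symm (q.adj_getVert_succ hi) hu fun h => ?_
    have := hinj (by omega) (by omega) h
    omega
  have hpos : 0 < q.length := by
    by_contra h0
    obtain ⟨z, hz⟩ := hK.nonempty
    refine hK.notMem (hG.mem_of_adj_closed hz (fun u hu v huv => ?_) x)
    rcases hK.adj u hu v huv with h | rfl
    · exact h
    · have := hmax u (.cons huv.symm .nil) (by simp [huv.ne']) (by simp [hu])
      simp at this
      omega
  have hb : b ∈ K := by simpa using hmem le_rfl hpos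
  have hclosed : ∀ u ∈ q.support, u ≠ x → ∀ v, G.Adj u v → v ∈ q.support := by
    intro u hu hux v huv
    obtain ⟨i, rfl, hi⟩ := Walk.mem_support_iff_exists_getVert.1 hu
    have h0 : 0 < i := Nat.pos_of_ne_zero fun h => hux (by simp [h])
    rcases hi.lt_or_eq with hi | rfl
    · rcases hmid h0 hi huv with rfl | rfl <;> exact q.getVert_mem_support _
    · rw [Walk.getVert_length] at huv
      exact hlast v hb huv
  have hxb : G.Adj x b := by
    rcases Nat.lt_or_ge 1 q.length with h1 | h1
    · by_contra hxb
      -- otherwise `b` has only one neighbour and is a smaller branch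
      have hbr : G.IsBranchAt (q.getVert (q.length - 1)) {b} := by
        refine ⟨fun h => ?_, ⟨b, rfl⟩, ?_⟩
        · have := hinj (by omega) le_rfl (h.trans q.getVert_length.symm)
          omega
        · rintro _ rfl v hv
          obtain ⟨i, rfl, hi⟩ := Walk.mem_support_iff_exists_getVert.1 (hlast v hb hv)
          have h0 : 0 < i := Nat.pos_of_ne_zero fun h => by
            subst h
            exact hxb (by simpa using hv.symm)
          have hil : i ≠ q.length := fun h => hv.ne' (by simp [h])
          rcases hmid h0 (by omega) hv.symm with h | h
          · have := hinj (i := q.length) (j := i - 1) le_rfl (by omega) (by simpa using h)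
            omega
          · have := hinj (i := q.length) (j := i + 1) le_rfl (by omega) (by simpa using h)
            right
            rw [this, Nat.add_sub_cancel]
      have h2 : ({q.getVert 1, b} : Set V) ⊆ K := by
        rintro _ (rfl | rfl)
        exacts [hmem h1.le one_pos, hb]
      have h3 := Set.ncard_le_ncard h2
      rw [Set.ncard_pair fun h => h1.ne (hinj h1.le le_rfl (by simpa using h))] at h3
      have h4 := hmin _ _ hbr
      rw [Set.ncard_singleton] at h4
      omega
    · have := q.adj_getVert_succ hpos
      rwa [Walk.getVert_zero, show 0 + 1 = q.length by omega, Walk.getVert_length] at this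
  refine ⟨x, b, q, hq, hxb, hclosed, fun i j hij hj hadj => ?_⟩
  rcases Nat.eq_zero_or_pos i with rfl | hi
  · rcases hj.lt_or_eq with hj' | rfl
    · rcases hmid hij hj' hadj.symm with h | h
      · have := hinj (by omega) (by omega) h
        omega
      · have := hinj (by omega) (by omega) h
        omega
    · exact Or.inr ⟨rfl, rfl⟩
  · rcases hmid hi (hij.trans_le hj) hadj with h | h
    · have := hinj hj (by omega) h
      omega
    · have := hinj hj (by omega) h
      exact Or.inl this

/-- Removing an end block from a connected graph, but not the vertex where it is attached, leaves a
connected graph. -/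
lemma Connected.induce_compl_of_isBranchAt (hG : G.Connected) {x : V} {K : Set V}
    (hK : G.IsBranchAt x K) : (G.induce Kᶜ).Connected := by
  have key : ∀ v, v ∈ {v | ∀ hv : v ∈ Kᶜ, (G.induce Kᶜ).Reachable ⟨x, hK.notMem⟩ ⟨v, hv⟩} := by
    refine hG.mem_of_adj_closed (x := x) (fun _ => Reachable.refl _) fun u hu v huv hv => ?_
    by_cases huK : u ∈ K
    · obtain rfl := (hK.adj u huK v huv).resolve_left hv
      rfl
    · exact (hu huK).trans (Adj.reachable (by simpa using huv))
  have : Nonempty ↥Kᶜ := ⟨⟨x, hK.notMem⟩⟩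
  exact ⟨fun u v => (key u u.2).symm.trans (key v v.2)⟩

lemma HasTripleBranch.of_induce {S : Set V} (h : (G.induce S).HasTripleBranch) :
    G.HasTripleBranch := by
  obtain ⟨x, t, ht, hxt, hj⟩ := h
  refine ⟨x, fun i => t i, Subtype.val_injective.comp ht, hxt, fun i j => ?_⟩
  obtain ⟨p, hp⟩ := hj i j
  let φ : G.induce S →g G := ⟨Subtype.val, fun h => h⟩
  refine ⟨p.map φ, fun h => ?_⟩
  rw [Walk.support_map, List.mem_map] at h
  obtain ⟨z, hz, hzx⟩ := h
  exact hp ((Subtype.val_injective hzx : z = x) ▸ hz)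

end SimpleGraph

namespace SimpleGraph

/-! ### Straight-line drawings -/

/-- `p` draws the part of the graph `H` on the vertex set `S` in the complex plane with straight
edges and without crossings. -/
structure IsStraightDrawingOn {W : Type*} (H : SimpleGraph W) (S : Set W) (p : W → ℂ) : Prop where
  injOn : Set.InjOn p S
  vertex : ∀ u ∈ S, ∀ v ∈ S, H.Adj u v → ∀ w ∈ S, p w ∈ segment ℝ (p u) (p v) → w = u ∨ w = v
  edge : ∀ u ∈ S, ∀ v ∈ S, ∀ w ∈ S, ∀ z ∈ S, H.Adj u v → H.Adj w z → s(u, v) ≠ s(w, z) →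
    ∀ x ∈ segment ℝ (p u) (p v), x ∈ segment ℝ (p w) (p z) →
      ∃ y, (y = u ∨ y = v) ∧ (y = w ∨ y = z) ∧ x = p y

variable {W : Type*} {H : SimpleGraph W} {S T : Set W} {p : W → ℂ}

theorem IsStraightDrawingOn.isPlanar (h : H.IsStraightDrawingOn Set.univ p) : H.IsPlanar := by
  let φ := Complex.equivRealProdCLM
  let A : Sym2 W → Set (ℝ × ℝ) := Sym2.lift ⟨fun u v => φ '' segment ℝ (p u) (p v),
    fun u v => by beta_reduce; rw [segment_symm]⟩
  have hA (u v : W) : A s(u, v) = φ '' segment ℝ (p u) (p v) := rfl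
  have hinj : Function.Injective p := fun u v => h.injOn (Set.mem_univ u) (Set.mem_univ v)
  refine ⟨⟨fun w => φ (p w), A, φ.injective.comp hinj, ?_, ?_, ?_⟩⟩
  · intro u v huv
    have hne : p u ≠ p v := hinj.ne huv.ne
    let γ : _root_.Path (p u) (p v) :=
      ⟨⟨fun t : unitInterval => AffineMap.lineMap (p u) (p v) (t : ℝ), by
        simp only [AffineMap.lineMap_apply]; fun_prop⟩, by simp, by simp⟩
    refine ⟨γ.map φ.continuous, fun s t hst => ?_, ?_⟩
    · exact Subtype.ext (AffineMap.lineMap_injective ℝ hne (φ.injective hst))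
    · rw [hA, segment_eq_image_lineMap]
      ext z
      simp only [Set.mem_range, Set.mem_image]
      constructor
      · rintro ⟨t, rfl⟩
        exact ⟨_, ⟨t, t.2, rfl⟩, rfl⟩
      · rintro ⟨_, ⟨t, ht, rfl⟩, rfl⟩
        exact ⟨⟨t, ht⟩, rfl⟩
  · intro e he w hw
    induction e with
    | h u v =>
      obtain ⟨x, hx, hxw⟩ := hw
      rw [φ.injective hxw] at hx
      simpa using h.vertex u (Set.mem_univ _) v (Set.mem_univ _) he w (Set.mem_univ _) hx
  · intro e he f hf hef x hx
    induction e with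
    | h u v =>
      induction f with
      | h w z =>
        obtain ⟨⟨x1, hx1, rfl⟩, ⟨x2, hx2, h12⟩⟩ := hx
        rw [φ.injective h12] at hx2
        obtain ⟨y, hy1, hy2, rfl⟩ := h.edge u (Set.mem_univ _) v (Set.mem_univ _) w
          (Set.mem_univ _) z (Set.mem_univ _) he hf hef x1 hx1 hx2
        exact ⟨y, by simpa using hy1, by simpa using hy2, rfl⟩

lemma IsStraightDrawingOn.congr {q : W → ℂ} (h : H.IsStraightDrawingOn S p)
    (hpq : Set.EqOn p q S) : H.IsStraightDrawingOn S q := by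
  refine ⟨h.injOn.congr hpq, fun u hu v hv huv w hw => ?_,
    fun u hu v hv w hw z hz huv hwz hne x hx hx' => ?_⟩
  · rw [← hpq hu, ← hpq hv, ← hpq hw]
    exact h.vertex u hu v hv huv w hw
  · rw [← hpq hu, ← hpq hv] at hx
    rw [← hpq hw, ← hpq hz] at hx'
    obtain ⟨y, hy1, hy2, hy3⟩ := h.edge u hu v hv w hw z hz huv hwz hne x hx hx'
    have hy : y ∈ S := by rcases hy1 with rfl | rfl <;> assumption
    exact ⟨y, hy1, hy2, by rw [← hpq hy, hy3]⟩

/-- The image of a straight-line drawing under an injective affine map. -/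
lemma IsStraightDrawingOn.map (h : H.IsStraightDrawingOn S p) (f : ℂ →ᵃ[ℝ] ℂ)
    (hf : Function.Injective f) : H.IsStraightDrawingOn S (fun w => f (p w)) := by
  refine ⟨hf.comp_injOn h.injOn, fun u hu v hv huv w hw hx => ?_,
    fun u hu v hv w hw z hz huv hwz hne x hx hx' => ?_⟩
  · rw [← image_segment, hf.mem_set_image] at hx
    exact h.vertex u hu v hv huv w hw hx
  · rw [← image_segment] at hx hx'
    obtain ⟨x, hx, rfl⟩ := hx
    rw [hf.mem_set_image] at hx'
    obtain ⟨y, hy1, hy2, rfl⟩ := h.edge u hu v hv w hw z hz huv hwz hne x hx hx'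
    exact ⟨y, hy1, hy2, rfl⟩

/-- Two drawings can be united if the second one, up to its common vertices with the first one, lies
in a region that the first one avoids. -/
lemma IsStraightDrawingOn.union (hS : H.IsStraightDrawingOn S p) (hT : H.IsStraightDrawingOn T p)
    {Q : Set ℂ} (hcov : ∀ u ∈ S ∪ T, ∀ v ∈ S ∪ T, H.Adj u v → u ∈ S ∧ v ∈ S ∨ u ∈ T ∧ v ∈ T)
    (hSQ : ∀ w ∈ S, p w ∉ Q)
    (hSQ' : ∀ u ∈ S, ∀ v ∈ S, H.Adj u v → ∀ x ∈ segment ℝ (p u) (p v), x ∉ Q)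
    (hTQ : ∀ w ∈ T, w ∉ S → p w ∈ Q)
    (hTQ' : ∀ u ∈ T, u ∉ S → ∀ v ∈ T, H.Adj u v → ∀ x ∈ segment ℝ (p u) (p v),
      x ∈ Q ∨ v ∈ S ∧ x = p v) :
    H.IsStraightDrawingOn (S ∪ T) p := by
  have hcov' {u v} (hu : u ∈ S ∪ T) (hv : v ∈ S ∪ T) (huv : H.Adj u v) :
      u ∈ S ∧ v ∈ S ∨ (u ∈ T ∧ v ∈ T ∧ ∀ x ∈ segment ℝ (p u) (p v), x ∉ Q →
        ∃ y, (y = u ∨ y = v) ∧ y ∈ S ∧ x = p y) := by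
    by_cases hSS : u ∈ S ∧ v ∈ S
    · exact Or.inl hSS
    obtain ⟨hu, hv⟩ := (hcov u hu v hv huv).resolve_left hSS
    refine Or.inr ⟨hu, hv, fun x hx hxQ => ?_⟩
    by_cases huS : u ∈ S
    · have hvS : v ∉ S := fun h => hSS ⟨huS, h⟩
      rw [segment_symm] at hx
      exact ⟨u, Or.inl rfl, (hTQ' v hv hvS u hu huv.symm x hx).resolve_left hxQ⟩
    · exact ⟨v, Or.inr rfl, (hTQ' u hu huS v hv huv x hx).resolve_left hxQ⟩
  -- an edge of the first drawing against an edge of the second one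
  have mixed {u v w z x} (hu : u ∈ S) (hv : v ∈ S) (huv : H.Adj u v)
      (hnew : ∀ x ∈ segment ℝ (p w) (p z), x ∉ Q → ∃ y, (y = w ∨ y = z) ∧ y ∈ S ∧ x = p y)
      (hx : x ∈ segment ℝ (p u) (p v)) (hx' : x ∈ segment ℝ (p w) (p z)) :
      ∃ y, (y = u ∨ y = v) ∧ (y = w ∨ y = z) ∧ x = p y := by
    obtain ⟨y, hy, hyS, rfl⟩ := hnew x hx' (hSQ' u hu v hv huv x hx)
    exact ⟨y, hS.vertex u hu v hv huv y hyS hx, hy, rfl⟩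
  refine ⟨fun u hu v hv huv => ?_, fun u hu v hv huv w hw hx => ?_,
    fun u hu v hv w hw z hz huv hwz hne x hx hx' => ?_⟩
  · by_cases huS : u ∈ S <;> by_cases hvS : v ∈ S
    · exact hS.injOn huS hvS huv
    · exact absurd (huv ▸ hTQ v (hv.resolve_left hvS) hvS) (hSQ u huS)
    · exact absurd (huv ▸ hTQ u (hu.resolve_left huS) huS) (hSQ v hvS)
    · exact hT.injOn (hu.resolve_left huS) (hv.resolve_left hvS) huv
  · rcases hcov' hu hv huv with ⟨hu, hv⟩ | ⟨hu, hv, hnew⟩ <;> by_cases hwS : w ∈ S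
    · exact hS.vertex u hu v hv huv w hwS hx
    · exact absurd (hTQ w (hw.resolve_left hwS) hwS) (hSQ' u hu v hv huv _ hx)
    · obtain ⟨y, hy, hyS, hwy⟩ := hnew _ hx (hSQ w hwS)
      rwa [hS.injOn hwS hyS hwy]
    · exact hT.vertex u hu v hv huv w (hw.resolve_left hwS) hx
  · rcases hcov' hu hv huv with ⟨hu, hv⟩ | ⟨hu, hv, hnew⟩ <;>
      rcases hcov' hw hz hwz with ⟨hw, hz⟩ | ⟨hw, hz, hnew'⟩
    · exact hS.edge u hu v hv w hw z hz huv hwz hne x hx hx'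
    · exact mixed hu hv huv hnew' hx hx'
    · obtain ⟨y, h1, h2, h3⟩ := mixed hw hz hwz hnew hx' hx
      exact ⟨y, h2, h1, h3⟩
    · exact hT.edge u hu v hv w hw z hz huv hwz hne x hx hx'

/-! ### Inserting a drawing in a thin triangle at an edge -/

/-- The open triangle with base `[0, 1]` whose other two sides have slopes `ε` and `-ε`. -/
def thinTriangle (ε : ℝ) : Set ℂ := {z | 0 < z.im ∧ z.im < ε * z.re ∧ z.im < ε * (1 - z.re)}

open Filter Topology in
lemma eventually_segment_zero_notMem_thinTriangle (q : ℂ) :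
    ∀ᶠ ε in 𝓝[>] (0 : ℝ), ∀ z ∈ segment ℝ 0 q, z ∉ thinTriangle ε := by
  have hpos : ∀ᶠ ε in 𝓝[>] (0 : ℝ), 0 < ε := self_mem_nhdsWithin
  have hsmall : ∀ᶠ ε in 𝓝[>] (0 : ℝ), 0 < q.im → ε * q.re < q.im := by
    have : Tendsto (fun ε : ℝ => ε * q.re) (𝓝[>] 0) (𝓝 0) := by
      have : Continuous fun ε : ℝ => ε * q.re := by fun_prop
      simpa using (this.tendsto 0).mono_left nhdsWithin_le_nhds
    by_cases hq : 0 < q.im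
    · filter_upwards [this.eventually_lt_const hq] with ε h _ using h
    · exact Eventually.of_forall fun _ h => absurd h hq
  filter_upwards [hpos, hsmall] with ε hε hs z hz
  obtain ⟨a, b, ha, hb, hab, rfl⟩ := hz
  rintro ⟨h1, h2, -⟩
  simp only [smul_zero, zero_add, Complex.real_smul, Complex.re_ofReal_mul,
    Complex.im_ofReal_mul] at h1 h2
  have hq : 0 < q.im := by
    by_contra h
    nlinarith
  nlinarith [hs hq]

open Filter Topology in
lemma eventually_segment_one_notMem_thinTriangle (q : ℂ) :
    ∀ᶠ ε in 𝓝[>] (0 : ℝ), ∀ z ∈ segment ℝ 1 q, z ∉ thinTriangle ε := by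
  filter_upwards [eventually_segment_zero_notMem_thinTriangle ⟨1 - q.re, q.im⟩] with ε h z hz hzε
  refine h ⟨1 - z.re, z.im⟩ ?_ ⟨hzε.1, hzε.2.2, by simpa using hzε.2.1⟩
  obtain ⟨a, b, ha, hb, hab, rfl⟩ := hz
  refine ⟨a, b, ha, hb, hab, ?_⟩
  apply Complex.ext
  · simp
    linear_combination hab
  · simp

lemma isCompact_segment (a b : ℂ) : IsCompact (segment ℝ a b) := by
  rw [segment_eq_image_lineMap]
  exact isCompact_Icc.image AffineMap.lineMap_continuous

open Filter Topology in
lemma eventually_notMem_thinTriangle_of_disjoint {K : Set ℂ} (hK : IsCompact K)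
    (hd : Disjoint K (segment ℝ 0 1)) :
    ∀ᶠ ε in 𝓝[>] (0 : ℝ), ∀ z ∈ K, z ∉ thinTriangle ε := by
  obtain ⟨δ, hδ, hdis⟩ := hd.exists_thickenings hK (isCompact_segment 0 1).isClosed
  filter_upwards [Ioo_mem_nhdsGT hδ] with ε hε z hz hzε
  obtain ⟨h1, h2, h3⟩ := hzε
  have hre : 0 < z.re := by by_contra h; nlinarith [hε.1]
  have hre' : z.re < 1 := by by_contra h; nlinarith [hε.1]
  refine Set.disjoint_left.1 hdis (Metric.self_subset_thickening hδ K hz) ?_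
  rw [Metric.mem_thickening_iff]
  refine ⟨z.re, ⟨1 - z.re, z.re, by linarith, hre.le, by ring, by simp⟩, ?_⟩
  rw [Complex.dist_eq]
  have : z - z.re = z.im * Complex.I := by
    apply Complex.ext <;> simp
  rw [this, norm_mul, Complex.norm_I, mul_one, Complex.norm_real, Real.norm_eq_abs, abs_of_pos h1]
  nlinarith [hε.1, hε.2]

open Filter Topology in
/-- A thin triangle at an edge of a straight-line drawing meets no edge. -/
lemma IsStraightDrawingOn.exists_thinTriangle [Finite W] (h : H.IsStraightDrawingOn S p) {α β : W}
    (hα : α ∈ S) (hβ : β ∈ S) (hαβ : H.Adj α β) (h0 : p α = 0) (h1 : p β = 1) :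
    ∃ ε > 0, ∀ u ∈ S, ∀ v ∈ S, H.Adj u v → ∀ x ∈ segment ℝ (p u) (p v), x ∉ thinTriangle ε := by
  have key : ∀ u v, ∀ᶠ ε in 𝓝[>] (0 : ℝ), u ∈ S → v ∈ S → H.Adj u v →
      ∀ x ∈ segment ℝ (p u) (p v), x ∉ thinTriangle ε := by
    intro u v
    by_cases huS : u ∈ S
    swap; · exact Eventually.of_forall fun _ h => absurd h huS
    by_cases hvS : v ∈ S
    swap; · exact Eventually.of_forall fun _ _ h => absurd h hvS
    by_cases huv : H.Adj u v
    swap; · exact Eventually.of_forall fun _ _ _ h => absurd h huv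
    by_cases hα' : α = u ∨ α = v
    · filter_upwards [eventually_segment_zero_notMem_thinTriangle (p u),
        eventually_segment_zero_notMem_thinTriangle (p v)] with ε hu hv _ _ _ x hx
      rcases hα' with rfl | rfl
      · exact hv x (h0 ▸ hx)
      · exact hu x (by rw [segment_symm]; exact h0 ▸ hx)
    by_cases hβ' : β = u ∨ β = v
    · filter_upwards [eventually_segment_one_notMem_thinTriangle (p u),
        eventually_segment_one_notMem_thinTriangle (p v)] with ε hu hv _ _ _ x hx
      rcases hβ' with rfl | rfl
      · exact hv x (h1 ▸ hx)
      · exact hu x (by rw [segment_symm]; exact h1 ▸ hx)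
    have hdis : Disjoint (segment ℝ (p u) (p v)) (segment ℝ 0 1) := by
      rw [Set.disjoint_left]
      intro x hx hx'
      rw [← h0, ← h1] at hx'
      obtain ⟨y, hy, hy', -⟩ := h.edge u huS v hvS α hα β hβ huv hαβ (fun he => by
        have : α ∈ s(u, v) := he ▸ Sym2.mem_mk_left α β
        exact hα' (by simpa using this)) x hx hx'
      rcases hy' with rfl | rfl
      exacts [hα' hy, hβ' hy]
    filter_upwards [eventually_notMem_thinTriangle_of_disjoint (isCompact_segment _ _) hdis]
      with ε h _ _ _ using h
  have hpos : ∀ᶠ ε in 𝓝[>] (0 : ℝ), 0 < ε := self_mem_nhdsWithin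
  obtain ⟨ε, hε, h⟩ := (hpos.and (eventually_all.2 fun u => eventually_all.2 (key u))).exists
  exact ⟨ε, hε, fun u hu v hv huv => h u v hu hv huv⟩

/-- A straight-line drawing on `S` and one on `T`, where `S` and `T` have exactly the ends of an
edge `αβ` in common, give one on `S ∪ T` if the second one lies in a triangle with base `αβ`. -/
theorem IsStraightDrawingOn.exists_union [Finite W] {q : W → ℂ} {α β : W}
    (hS : H.IsStraightDrawingOn S p) (hT : H.IsStraightDrawingOn T q) (hαβ : H.Adj α β)
    (hST : S ∩ T = {α, β})
    (hcov : ∀ u ∈ S ∪ T, ∀ v ∈ S ∪ T, H.Adj u v → u ∈ S ∧ v ∈ S ∨ u ∈ T ∧ v ∈ T)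
    (hSdeg : ∀ w ∈ S, ∃ z ∈ S, H.Adj w z) (h0 : q α = 0) (h1 : q β = 1)
    {C : ℝ} (hC : 0 < C) (hTC : ∀ w ∈ T, w ∉ S → q w ∈ thinTriangle C) :
    ∃ r, H.IsStraightDrawingOn (S ∪ T) r := by
  classical
  have hα : α ∈ S ∩ T := hST ▸ Or.inl rfl
  have hβ : β ∈ S ∩ T := hST ▸ Or.inr rfl
  have hne : p β - p α ≠ 0 := sub_ne_zero.2 fun h => hαβ.ne (hS.injOn hβ.1 hα.1 h).symm
  -- a similarity moves the edge `αβ` to the base of the thin triangles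
  let f : ℂ →ᵃ[ℝ] ℂ := (LinearMap.mulLeft ℝ (p β - p α)⁻¹).toAffineMap.comp
    (AffineMap.id ℝ ℂ - AffineMap.const ℝ ℂ (p α))
  have hf (z) : f z = (p β - p α)⁻¹ * (z - p α) := rfl
  have hfS := hS.map f fun z w hzw => by
    rw [hf, hf] at hzw
    exact sub_left_injective (mul_left_cancel₀ (inv_ne_zero hne) hzw)
  have hfα : f (p α) = 0 := by simp [hf]
  have hfβ : f (p β) = 1 := by rw [hf, inv_mul_cancel₀ hne]
  obtain ⟨ε, hε, hthin⟩ := hfS.exists_thinTriangle hα.1 hβ.1 hαβ hfα hfβ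
  -- the second drawing is flattened until it fits in a thin triangle
  let g : ℂ →ᵃ[ℝ] ℂ := LinearMap.toAffineMap
    { toFun := fun z => ⟨z.re, ε / C * z.im⟩
      map_add' := fun z w => by apply Complex.ext <;> simp [mul_add]
      map_smul' := fun c z => by apply Complex.ext <;> simp; ring }
  have hg (z) : g z = ⟨z.re, ε / C * z.im⟩ := rfl
  have hεC : 0 < ε / C := div_pos hε hC
  have hgT := hT.map g fun z w hzw => by
    rw [hg, hg, Complex.mk.injEq] at hzw
    exact Complex.ext hzw.1 (mul_left_cancel₀ hεC.ne' hzw.2)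
  have hgC {z} (hz : z ∈ thinTriangle C) : g z ∈ thinTriangle ε := by
    obtain ⟨z1, z2, z3⟩ := hz
    rw [hg]
    refine ⟨mul_pos hεC z1, ?_, ?_⟩
    · calc ε / C * z.im < ε / C * (C * z.re) := mul_lt_mul_of_pos_left z2 hεC
        _ = ε * z.re := by field_simp
    · calc ε / C * z.im < ε / C * (C * (1 - z.re)) := mul_lt_mul_of_pos_left z3 hεC
        _ = ε * (1 - z.re) := by field_simp
  have hg0 : g (q α) = 0 := by rw [h0, hg]; apply Complex.ext <;> simp
  have hg1 : g (q β) = 1 := by rw [h1, hg]; apply Complex.ext <;> simp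
  let r : W → ℂ := fun w => if w ∈ S then f (p w) else g (q w)
  have hrS : Set.EqOn (fun w => f (p w)) r S := fun w hw => (if_pos hw).symm
  have hrT : Set.EqOn (fun w => g (q w)) r T := by
    intro w hw
    by_cases hwS : w ∈ S
    · have : w ∈ ({α, β} : Set W) := hST ▸ ⟨hwS, hw⟩
      simp only [r, if_pos hwS]
      rcases this with rfl | rfl
      · rw [hg0, hfα]
      · rw [hg1, hfβ]
    · exact (if_neg hwS).symm
  have hTr : ∀ w ∈ T, w ∉ S → r w ∈ thinTriangle ε := fun w hw hwS => by
    rw [← hrT hw]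
    exact hgC (hTC w hw hwS)
  have hSr : ∀ u ∈ S, ∀ v ∈ S, H.Adj u v → ∀ x ∈ segment ℝ (r u) (r v), x ∉ thinTriangle ε := by
    intro u hu v hv huv
    rw [← hrS hu, ← hrS hv]
    exact hthin u hu v hv huv
  refine ⟨r, (hfS.congr hrS).union (hgT.congr hrT) (Q := thinTriangle ε) hcov ?_ hSr hTr ?_⟩
  · intro w hw
    obtain ⟨z, hz, hwz⟩ := hSdeg w hw
    exact hSr w hw z hz hwz _ (left_mem_segment ℝ _ _)
  · intro u hu huS v hv huv x hx
    obtain ⟨a, b, ha, hb, hab, rfl⟩ := hx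
    obtain ⟨u1, u2, u3⟩ := hTr u hu huS
    have hv' : 0 ≤ (r v).im ∧ (r v).im ≤ ε * (r v).re ∧ (r v).im ≤ ε * (1 - (r v).re) := by
      by_cases hvS : v ∈ S
      · have : v ∈ ({α, β} : Set W) := hST ▸ ⟨hvS, hv⟩
        rw [← hrT hv]
        rcases this with rfl | rfl
        · simp [hg0, hε.le]
        · simp [hg1, hε.le]
      · obtain ⟨v1, v2, v3⟩ := hTr v hv hvS
        exact ⟨v1.le, v2.le, v3.le⟩
    rcases ha.eq_or_lt with rfl | ha
    · obtain rfl : b = 1 := by linarith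
      by_cases hvS : v ∈ S
      · exact Or.inr ⟨hvS, by simp⟩
      · left
        simpa using hTr v hv hvS
    · left
      refine ⟨?_, ?_, ?_⟩ <;> simp only [Complex.add_re, Complex.add_im, Complex.real_smul,
        Complex.re_ofReal_mul, Complex.im_ofReal_mul]
      · have := mul_pos ha u1
        have := mul_nonneg hb hv'.1
        linarith
      · have h3 := mul_lt_mul_of_pos_left u2 ha
        have h4 := mul_le_mul_of_nonneg_left hv'.2.1 hb
        linarith
      · have h3 := mul_lt_mul_of_pos_left u3 ha
        have h4 := mul_le_mul_of_nonneg_left hv'.2.2 hb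
        have h5 : ε * (1 - (a * (r u).re + b * (r v).re)) =
            a * (ε * (1 - (r u).re)) + b * (ε * (1 - (r v).re)) := by
          linear_combination (-ε) * hab
        linarith

end SimpleGraph

namespace SimpleGraph

/-! ### Crossings of straight edges -/

/-- The straight edges `ab` and `cd` meet at most in common ends. -/
def MeetInEnds {W : Type*} (p : W → ℂ) (a b c d : W) : Prop :=
  ∀ x ∈ segment ℝ (p a) (p b), x ∈ segment ℝ (p c) (p d) →
    ∃ y, (y = a ∨ y = b) ∧ (y = c ∨ y = d) ∧ x = p y

section MeetInEnds

variable {W : Type*} {p : W → ℂ} {a b c d : W}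

lemma MeetInEnds.symm (h : MeetInEnds p a b c d) : MeetInEnds p c d a b := fun x hx hx' =>
  let ⟨y, h1, h2, h3⟩ := h x hx' hx
  ⟨y, h2, h1, h3⟩

lemma MeetInEnds.swap_left (h : MeetInEnds p a b c d) : MeetInEnds p b a c d := fun x hx hx' =>
  let ⟨y, h1, h2, h3⟩ := h x (segment_symm ℝ (p b) (p a) ▸ hx) hx'
  ⟨y, h1.symm, h2, h3⟩

lemma MeetInEnds.swap_right (h : MeetInEnds p a b c d) : MeetInEnds p a b d c :=
  h.symm.swap_left.symm

/-- A segment that lies on one side of a line and one that lies on the other side meet at most in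
the one end where the first segment reaches the line. -/
lemma eq_of_mem_segment_of_separated {P Q R S x : ℂ} (α β γ : ℝ) (hP : α * P.re + β * P.im < γ)
    (hQ : α * Q.re + β * Q.im ≤ γ) (hR : γ ≤ α * R.re + β * R.im)
    (hS : γ ≤ α * S.re + β * S.im) (hx : x ∈ segment ℝ P Q) (hx' : x ∈ segment ℝ R S) :
    x = Q ∧ α * Q.re + β * Q.im = γ := by
  obtain ⟨s, t, hs, ht, hst, rfl⟩ := hx
  obtain ⟨s', t', hs', ht', hst', hx⟩ := hx'
  have hre := congrArg Complex.re hx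
  have him := congrArg Complex.im hx
  simp only [Complex.add_re, Complex.add_im, Complex.real_smul, Complex.re_ofReal_mul,
    Complex.im_ofReal_mul] at hre him
  have h1 : γ ≤ α * (s * P.re + t * Q.re) + β * (s * P.im + t * Q.im) := by
    rw [← hre, ← him]
    have := mul_le_mul_of_nonneg_left hR hs'
    have := mul_le_mul_of_nonneg_left hS ht'
    have e : γ = s' * γ + t' * γ := by rw [← add_mul, hst', one_mul]
    linarith
  have e : γ = s * γ + t * γ := by rw [← add_mul, hst, one_mul]
  have h2 := mul_le_mul_of_nonneg_left hQ ht
  have h3 : s = 0 := by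
    by_contra h
    have := mul_lt_mul_of_pos_left hP (lt_of_le_of_ne hs (Ne.symm h))
    linarith
  subst h3
  obtain rfl : t = 1 := by linarith
  exact ⟨by simp, le_antisymm hQ (by linarith)⟩

lemma MeetInEnds.of_separated (α β γ : ℝ) (ha : α * (p a).re + β * (p a).im < γ)
    (hb : α * (p b).re + β * (p b).im < γ) (hc : γ ≤ α * (p c).re + β * (p c).im)
    (hd : γ ≤ α * (p d).re + β * (p d).im) : MeetInEnds p a b c d := fun _ hx hx' =>
  absurd (eq_of_mem_segment_of_separated α β γ ha hb.le hc hd hx hx').2 hb.ne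

/-- Two segments with a common end that are not parallel meet only in this end. -/
lemma MeetInEnds.of_common_end {q u v : W} (h : ((p u).re - (p q).re) * ((p v).im - (p q).im) -
    ((p u).im - (p q).im) * ((p v).re - (p q).re) ≠ 0) : MeetInEnds p q u q v := by
  rintro x ⟨s, t, -, -, hst, rfl⟩ ⟨s', t', -, -, hst', hx⟩
  have hre := congrArg Complex.re hx
  have him := congrArg Complex.im hx
  simp only [Complex.add_re, Complex.add_im, Complex.real_smul, Complex.re_ofReal_mul,
    Complex.im_ofReal_mul] at hre him
  obtain rfl : s = 1 - t := by linarith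
  obtain rfl : s' = 1 - t' := by linarith
  have ht : t * (((p u).re - (p q).re) * ((p v).im - (p q).im) -
    ((p u).im - (p q).im) * ((p v).re - (p q).re)) = 0 := by
    linear_combination ((p v).re - (p q).re) * him - ((p v).im - (p q).im) * hre
  obtain rfl := (mul_eq_zero.1 ht).resolve_right h
  exact ⟨q, Or.inl rfl, Or.inl rfl, by simp⟩

/-- The edge `cd` lies on a line, and the edge `ab` lies strictly on one side of it, unless it
ends in `c`. -/
lemma MeetInEnds.of_line (α β γ : ℝ) (hab : a ≠ b) (hc : α * (p c).re + β * (p c).im = γ)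
    (hd : α * (p d).re + β * (p d).im = γ) (ha : a = c ∨ α * (p a).re + β * (p a).im < γ)
    (hb : b = c ∨ α * (p b).re + β * (p b).im < γ) : MeetInEnds p a b c d := by
  rcases ha with rfl | ha <;> rcases hb with rfl | hb
  · exact absurd rfl hab
  · intro x hx hx'
    rw [segment_symm] at hx
    exact ⟨a, Or.inl rfl, Or.inl rfl,
      (eq_of_mem_segment_of_separated α β γ hb hc.le hc.ge hd.ge hx hx').1⟩
  · intro x hx hx'
    exact ⟨b, Or.inr rfl, Or.inl rfl,
      (eq_of_mem_segment_of_separated α β γ ha hc.le hc.ge hd.ge hx hx').1⟩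
  · exact .of_separated α β γ ha hb hc.ge hd.ge

/-- In a drawing without isolated vertices it suffices to check pairs of edges. -/
lemma IsStraightDrawingOn.of_meetInEnds {H : SimpleGraph W} {S : Set W} (hinj : Set.InjOn p S)
    (hdeg : ∀ w ∈ S, ∃ z ∈ S, H.Adj w z)
    (h : ∀ u ∈ S, ∀ v ∈ S, ∀ w ∈ S, ∀ z ∈ S, H.Adj u v → H.Adj w z → s(u, v) ≠ s(w, z) →
      MeetInEnds p u v w z) : H.IsStraightDrawingOn S p := by
  refine ⟨hinj, fun u hu v hv huv w hw hx => ?_, h⟩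
  obtain ⟨z, hz, hwz⟩ := hdeg w hw
  by_cases he : s(u, v) = s(w, z)
  · have : w ∈ s(u, v) := he ▸ Sym2.mem_mk_left w z
    simpa using this
  · obtain ⟨y, hy, -, hwy⟩ := h u hu v hv w hw z hz huv hwz he _ hx (left_mem_segment ℝ _ _)
    have hyS : y ∈ S := by rcases hy with rfl | rfl <;> assumption
    rwa [hinj hw hyS hwy]

end MeetInEnds

/-! ### A drawing of the great shadow of an even cycle -/

/-- The point for the end on side `v.2` (left for `false`, right for `true`) of the rung `v.1` of a
closed ladder with rungs `0, …, m`. The rungs below `m` are horizontal, at the height of their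
index; the rung `0` is the interval `[0, 1]`. The right end of the rung `m` is an apex high above
everything else, so that the ladder can be closed on both sides of the rungs in between. -/
noncomputable def ladderPoint (m : ℕ) (v : ℕ × Bool) : ℂ :=
  if v.1 = 0 then (if v.2 then 1 else 0)
  else if v.1 = m ∧ v.2 = true then ⟨1 / 2, 2 * m⟩
  else ⟨if v.2 then 3 / 5 else 2 / 5, v.1⟩

/-- The edges of a closed ladder that are incident with its last rung `t b`: the edges to the rung
`t' b'` before it and the rung itself (indices `0` to `3`), and the edges to the first rung `t₀ b₀`
(indices `4` to `6`). -/
def outerEdge {W : Type*} (t' b' t b t₀ b₀ : W) : Fin 7 → W × W :=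
  ![(t', t), (t, b), (t', b), (b', b), (t₀, t), (t₀, b), (b₀, b)]

/-- The edges of a closed ladder with rungs `0, …, m` that are incident with the rung `m`. -/
def outerLadderEdge (m : ℕ) : Fin 7 → (ℕ × Bool) × (ℕ × Bool) :=
  outerEdge (m - 1, false) (m - 1, true) (m, false) (m, true) (0, false) (0, true)

/-- The edges of a closed ladder with rungs `0, …, m`, with one diagonal in each of the
quadrilaterals between consecutive rungs. The side where the diagonal between the rungs `i` and
`i + 1` starts is `σ i`. If `m = 1`, the edges to the rung `m - 1` are those to the rung `0`, and
only the latter description is used. -/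
inductive LadderEdge (m : ℕ) (σ : ℕ → Bool) : ℕ × Bool → ℕ × Bool → Prop
  | rung {i : ℕ} (hi : i < m) : LadderEdge m σ (i, false) (i, true)
  | slab {i : ℕ} {s r : Bool} (hi : i + 1 < m) (h : s = r ∨ s = σ i ∧ r = !s) :
      LadderEdge m σ (i, s) (i + 1, r)
  | outer (k : Fin 7) (hk : k = 0 ∨ k = 2 ∨ k = 3 → 2 ≤ m) :
      LadderEdge m σ (outerLadderEdge m k).1 (outerLadderEdge m k).2

section Ladder

variable {m : ℕ} {σ : ℕ → Bool}

lemma ladderPoint_zero_left : ladderPoint m (0, false) = 0 := by simp [ladderPoint]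

lemma ladderPoint_zero_right : ladderPoint m (0, true) = 1 := by simp [ladderPoint]

lemma ladderPoint_left {i : ℕ} (hi : 0 < i) : ladderPoint m (i, false) = ⟨2 / 5, i⟩ := by
  simp [ladderPoint, hi.ne']

lemma ladderPoint_right {i : ℕ} (hi : 0 < i) (him : i < m) :
    ladderPoint m (i, true) = ⟨3 / 5, i⟩ := by
  simp [ladderPoint, hi.ne', him.ne]

lemma ladderPoint_apex (hm : 0 < m) : ladderPoint m (m, true) = ⟨1 / 2, 2 * m⟩ := by
  simp [ladderPoint, hm.ne']

lemma ladderPoint_im {i : ℕ} {s : Bool} (hi : i < m) : (ladderPoint m (i, s)).im = i := by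
  rcases Nat.eq_zero_or_pos i with rfl | h0
  · cases s <;> simp [ladderPoint_zero_left, ladderPoint_zero_right]
  · cases s <;> simp [ladderPoint_left, ladderPoint_right, h0, hi]

lemma ladderPoint_left_re_le (i : ℕ) : (ladderPoint m (i, false)).re ≤ 2 / 5 := by
  rcases Nat.eq_zero_or_pos i with rfl | h0
  · norm_num [ladderPoint_zero_left]
  · simp [ladderPoint_left, h0]

lemma ladderPoint_right_le_re {i : ℕ} (hi : i < m) : 3 / 5 ≤ (ladderPoint m (i, true)).re := by
  rcases Nat.eq_zero_or_pos i with rfl | h0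
  · norm_num [ladderPoint_zero_right]
  · simp [ladderPoint_right, h0, hi]

/-- The vertices of the closed ladder, with their points. -/
lemma ladderPoint_cases {v : ℕ × Bool} (hv : v.1 ≤ m) (hm : 0 < m) :
    v = (0, false) ∧ ladderPoint m v = 0 ∨ v = (0, true) ∧ ladderPoint m v = 1 ∨
    v = (m, true) ∧ ladderPoint m v = ⟨1 / 2, 2 * m⟩ ∨
    (∃ i, 0 < i ∧ i ≤ m ∧ v = (i, false) ∧ ladderPoint m v = ⟨2 / 5, i⟩) ∨
    ∃ i, 0 < i ∧ i < m ∧ v = (i, true) ∧ ladderPoint m v = ⟨3 / 5, i⟩ := by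
  obtain ⟨i, s⟩ := v
  change i ≤ m at hv
  rcases Nat.eq_zero_or_pos i with rfl | h0
  · cases s
    · exact Or.inl ⟨rfl, ladderPoint_zero_left⟩
    · exact Or.inr (Or.inl ⟨rfl, ladderPoint_zero_right⟩)
  · cases s
    · exact Or.inr (Or.inr (Or.inr (Or.inl ⟨i, h0, hv, rfl, ladderPoint_left h0⟩)))
    · rcases hv.eq_or_lt with rfl | him
      · exact Or.inr (Or.inr (Or.inl ⟨rfl, ladderPoint_apex hm⟩))
      · exact Or.inr (Or.inr (Or.inr (Or.inr ⟨i, h0, him, rfl, ladderPoint_right h0 him⟩)))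

lemma ladderPoint_injOn (hm : 0 < m) : Set.InjOn (ladderPoint m) {v | v.1 ≤ m} := by
  intro u hu v hv huv
  have hm' : (0 : ℝ) < m := by exact_mod_cast hm
  rcases ladderPoint_cases hu hm with ⟨rfl, h⟩ | ⟨rfl, h⟩ | ⟨rfl, h⟩ | ⟨i, hi, hi', rfl, h⟩ |
      ⟨i, hi, hi', rfl, h⟩ <;>
    rcases ladderPoint_cases hv hm with ⟨rfl, h'⟩ | ⟨rfl, h'⟩ | ⟨rfl, h'⟩ | ⟨j, hj, hj', rfl, h'⟩ |
      ⟨j, hj, hj', rfl, h'⟩ <;>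
    first
    | rfl
    | rw [h, h', Complex.ext_iff] at huv
      norm_num at huv <;> norm_num <;> exact huv

lemma ladderPoint_mem_thinTriangle (hm : 0 < m) {v : ℕ × Bool} (hv : v.1 ≤ m) (h0 : 0 < v.1) :
    ladderPoint m v ∈ thinTriangle (5 * m) := by
  have hm' : (0 : ℝ) < m := by exact_mod_cast hm
  rcases ladderPoint_cases hv hm with ⟨rfl, h⟩ | ⟨rfl, h⟩ | ⟨rfl, h⟩ | ⟨i, hi, hi', rfl, h⟩ |
      ⟨i, hi, hi', rfl, h⟩
  · simp at h0
  · simp at h0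
  · rw [h]
    refine ⟨?_, ?_, ?_⟩ <;> norm_num <;> linarith
  all_goals
    have hi1 : (0 : ℝ) < i := by exact_mod_cast hi
    have hi2 : (i : ℝ) ≤ m := by exact_mod_cast (by omega : i ≤ m)
    rw [h]
    refine ⟨?_, ?_, ?_⟩ <;> norm_num <;> linarith

/-- Two edges of which the first ends at a height where the second one starts, or below. -/
lemma meetInEnds_of_im_le (hm : 0 < m) {a b c d : ℕ × Bool} (hb : b.1 ≤ m) (hc : c.1 ≤ m)
    (hd : d.1 ≤ m) (hcd' : c ≠ d) (hne : s(a, b) ≠ s(c, d))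
    (hab : (ladderPoint m a).im < (ladderPoint m b).im ∨
      ∃ i < m, a = (i, false) ∧ b = (i, true))
    (hcd : (ladderPoint m c).im < (ladderPoint m d).im ∨
      ∃ i < m, c = (i, false) ∧ d = (i, true))
    (hbc : (ladderPoint m b).im ≤ (ladderPoint m c).im) :
    MeetInEnds (ladderPoint m) a b c d := by
  intro x hx hx'
  have hflat {i : ℕ} {v : ℕ × Bool} (hi : i < m) (hv : v.1 ≤ m) (h : (ladderPoint m v).im = i) :
      v.1 = i := by
    have hm' : (0 : ℝ) < m := by exact_mod_cast hm
    have hi' : (i : ℝ) < m := by exact_mod_cast hi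
    rcases ladderPoint_cases hv hm with ⟨rfl, h'⟩ | ⟨rfl, h'⟩ | ⟨rfl, h'⟩ | ⟨j, hj, hj', rfl, h'⟩ |
      ⟨j, hj, hj', rfl, h'⟩ <;> rw [h'] at h <;> norm_num at h ⊢
    · exact_mod_cast h
    · exact_mod_cast h
    · linarith
    · exact h
    · exact h
  rcases hab with hab | ⟨i, hi, rfl, rfl⟩ <;> rcases hcd with hcd | ⟨j, hj, rfl, rfl⟩
  · have h1 := (eq_of_mem_segment_of_separated 0 1 (ladderPoint m c).im (by linarith) (by linarith)
      (by linarith) (by linarith) hx hx').1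
    have h2 := (eq_of_mem_segment_of_separated 0 (-1) (-(ladderPoint m b).im)
      (by linarith) (by linarith) (by linarith) (by linarith)
      (segment_symm ℝ (ladderPoint m c) _ ▸ hx') hx).1
    exact ⟨b, Or.inr rfl, Or.inl (ladderPoint_injOn hm hb hc (h1.symm.trans h2)), h1⟩
  · rw [ladderPoint_im hj] at hbc
    obtain ⟨h1, h2⟩ := eq_of_mem_segment_of_separated 0 1 j (by linarith) (by linarith)
      (by rw [ladderPoint_im hj]; simp) (by rw [ladderPoint_im hj]; simp) hx hx'
    have h3 := hflat hj hb (by linarith)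
    refine ⟨b, Or.inr rfl, ?_, h1⟩
    obtain ⟨b1, b2⟩ := b
    obtain rfl : b1 = j := h3
    cases b2 <;> simp
  · rw [ladderPoint_im hi] at hbc
    obtain ⟨h1, h2⟩ := eq_of_mem_segment_of_separated 0 (-1) (-i) (by linarith) (by linarith)
      (by rw [ladderPoint_im hi]; simp) (by rw [ladderPoint_im hi]; simp)
      (segment_symm ℝ (ladderPoint m c) _ ▸ hx') hx
    have h3 := hflat hi hc (by linarith)
    refine ⟨c, ?_, Or.inl rfl, h1⟩
    obtain ⟨c1, c2⟩ := c
    obtain rfl : c1 = i := h3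
    cases c2 <;> simp
  · have hij : i < j := by
      rw [ladderPoint_im hi, ladderPoint_im hj] at hbc
      have : i ≤ j := by exact_mod_cast hbc
      refine this.lt_of_ne ?_
      rintro rfl
      exact hne rfl
    have hij' : (i : ℝ) < j := by exact_mod_cast hij
    refine MeetInEnds.of_separated 0 1 j ?_ ?_ ?_ ?_ x hx hx' <;>
      simp [ladderPoint_im hi, ladderPoint_im hj, hij]

/-- Two edges between the same consecutive rungs. -/
lemma meetInEnds_slab {i : ℕ} {s r s' r' : Bool} (hi : i + 1 < m)
    (h : s = r ∨ s = σ i ∧ r = !s) (h' : s' = r' ∨ s' = σ i ∧ r' = !s')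
    (hne : s((i, s), (i + 1, r)) ≠ s((i, s'), (i + 1, r'))) :
    MeetInEnds (ladderPoint m) (i, s) (i + 1, r) (i, s') (i + 1, r') := by
  have him (s) : (ladderPoint m (i, s)).im = i := ladderPoint_im (by omega)
  have him' (s) : (ladderPoint m (i + 1, s)).im = i + 1 := by
    rw [ladderPoint_im hi]; push_cast; rfl
  have hl := ladderPoint_left_re_le (m := m) i
  have hl' := ladderPoint_left_re_le (m := m) (i + 1)
  have hr := ladderPoint_right_le_re (m := m) (i := i) (by omega)
  have hr' := ladderPoint_right_le_re (m := m) hi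
  by_cases hs : s = s'
  · subst hs
    have hrr : r ≠ r' := fun h => hne (by rw [h])
    refine .of_common_end ?_
    rw [him, him', him']
    cases r <;> cases r' <;> simp at hrr <;> intro h <;> linarith
  · by_cases hrr : r = r'
    · subst hrr
      refine (MeetInEnds.of_common_end ?_).swap_left.swap_right
      rw [him, him, him']
      cases s <;> cases s' <;> simp at hs <;> intro h <;> linarith
    · have : s = r ∧ s' = r' := by
        rcases h with h | ⟨h, rfl⟩ <;> rcases h' with h' | ⟨h', rfl⟩
        · exact ⟨h, h'⟩
        · exact absurd (h ▸ Bool.eq_not_of_ne hs) hrr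
        · exact absurd (h' ▸ (Bool.eq_not_of_ne (Ne.symm hs)).symm) hrr
        · exact absurd (h.trans h'.symm) hs
      obtain ⟨rfl, rfl⟩ := this
      cases s <;> cases s' <;> simp at hs
      · exact .of_separated 1 0 (1 / 2) (by linarith) (by linarith) (by linarith) (by linarith)
      · exact (MeetInEnds.of_separated 1 0 (1 / 2) (by linarith) (by linarith) (by linarith)
          (by linarith)).symm

end Ladder

end SimpleGraph

namespace SimpleGraph

section Ladder

variable {m : ℕ} {σ : ℕ → Bool}

/-- The edges at the last rung of a closed ladder meet only in common ends. -/
lemma meetInEnds_outerEdge {W : Type*} {p : W → ℂ} {t' b' t b t₀ b₀ : W} {M : ℝ} (hM : 1 ≤ M)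
    (ht₀ : p t₀ = 0) (hb₀ : p b₀ = 1) (ht : p t = ⟨2 / 5, M⟩) (hb : p b = ⟨1 / 2, 2 * M⟩)
    {k l : Fin 7} (hkl : k < l)
    (h2 : (k = 0 ∨ k = 2 ∨ k = 3) ∨ (l = 0 ∨ l = 2 ∨ l = 3) →
      2 ≤ M ∧ p t' = ⟨2 / 5, M - 1⟩ ∧ p b' = ⟨3 / 5, M - 1⟩) :
    MeetInEnds p (outerEdge t' b' t b t₀ b₀ k).1 (outerEdge t' b' t b t₀ b₀ k).2
      (outerEdge t' b' t b t₀ b₀ l).1 (outerEdge t' b' t b t₀ b₀ l).2 := by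
  have common (q u v : W) := MeetInEnds.of_common_end (p := p) (q := q) (u := u) (v := v)
  have sep (x y z w : W) := MeetInEnds.of_separated (p := p) (a := x) (b := y) (c := z) (d := w)
  fin_cases k <;> fin_cases l <;> first | exact absurd hkl (by decide) | skip
  · obtain ⟨hM2, ht', hb'⟩ := h2 (by decide)
    refine (common t t' b ?_).swap_left
    simp only [ht', ht, hb]; intro h; linarith
  · obtain ⟨hM2, ht', hb'⟩ := h2 (by decide)
    refine common t' t b ?_
    simp only [ht', ht, hb]; intro h; linarith
  · obtain ⟨hM2, ht', hb'⟩ := h2 (by decide)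
    refine sep t' t b' b 1 0 (9 / 20) ?_ ?_ ?_ ?_ <;> simp only [ht', ht, hb', hb] <;> norm_num
  · obtain ⟨hM2, ht', hb'⟩ := h2 (by decide)
    refine (common t t' t₀ ?_).swap_left.swap_right
    norm_num [ht', ht, ht₀]
  · obtain ⟨hM2, ht', hb'⟩ := h2 (by decide)
    refine sep t' t t₀ b (-4 * M) 1 0 ?_ ?_ ?_ ?_ <;> simp [ht', ht, ht₀, hb] <;> linarith
  · obtain ⟨hM2, ht', hb'⟩ := h2 (by decide)
    refine sep t' t b₀ b (4 * M) 1 (4 * M) ?_ ?_ ?_ ?_ <;> simp [ht', ht, hb₀, hb] <;> linarith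
  · obtain ⟨hM2, ht', hb'⟩ := h2 (by decide)
    refine (common b t t' ?_).swap_left.swap_right
    simp only [ht', ht, hb]; intro h; linarith
  · obtain ⟨hM2, ht', hb'⟩ := h2 (by decide)
    refine (common b t b' ?_).swap_left.swap_right
    simp only [hb', ht, hb]; intro h; linarith
  · refine (common t b t₀ ?_).swap_right
    simp only [ht, hb, ht₀, Complex.zero_re, Complex.zero_im]; intro h; linarith
  · refine (common b t t₀ ?_).swap_left.swap_right
    simp only [ht, hb, ht₀, Complex.zero_re, Complex.zero_im]; intro h; linarith
  · refine (common b t b₀ ?_).swap_left.swap_right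
    simp only [ht, hb, hb₀, Complex.one_re, Complex.one_im]; intro h; linarith
  · obtain ⟨hM2, ht', hb'⟩ := h2 (by decide)
    refine (common b t' b' ?_).swap_left.swap_right
    simp only [ht', hb', hb]; intro h; linarith
  · obtain ⟨hM2, ht', hb'⟩ := h2 (by decide)
    refine sep t' b t₀ t (-20 * M) 1 (-(7 * M + 1 / 2)) ?_ ?_ ?_ ?_ <;>
      simp [ht', hb, ht₀, ht] <;> linarith
  · obtain ⟨hM2, ht', hb'⟩ := h2 (by decide)
    refine (common b t' t₀ ?_).swap_left.swap_right
    simp only [ht', hb, ht₀, Complex.zero_re, Complex.zero_im]; intro h; linarith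
  · obtain ⟨hM2, ht', hb'⟩ := h2 (by decide)
    refine (common b t' b₀ ?_).swap_left.swap_right
    simp only [ht', hb, hb₀, Complex.one_re, Complex.one_im]; intro h; linarith
  · obtain ⟨hM2, ht', hb'⟩ := h2 (by decide)
    refine sep b' b t₀ t (-1) 0 (-(9 / 20)) ?_ ?_ ?_ ?_ <;> norm_num [hb', hb, ht₀, ht]
  · obtain ⟨hM2, ht', hb'⟩ := h2 (by decide)
    refine (common b b' t₀ ?_).swap_left.swap_right
    simp only [hb', hb, ht₀, Complex.zero_re, Complex.zero_im]; intro h; linarith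
  · obtain ⟨hM2, ht', hb'⟩ := h2 (by decide)
    refine (common b b' b₀ ?_).swap_left.swap_right
    simp only [hb', hb, hb₀, Complex.one_re, Complex.one_im]; intro h; linarith
  · refine common t₀ t b ?_
    simp only [ht, hb, ht₀, Complex.zero_re, Complex.zero_im]; intro h; linarith
  · refine sep t₀ t b₀ b 1 0 (9 / 20) ?_ ?_ ?_ ?_ <;> norm_num [ht₀, ht, hb₀, hb]
  · refine (common b t₀ b₀ ?_).swap_left.swap_right
    simp only [hb, hb₀, ht₀, Complex.zero_re, Complex.zero_im, Complex.one_re, Complex.one_im]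
    intro h; linarith

/-- The edges of a closed ladder are the rungs below the last one and the edges between them, which
are described by the first alternative, and the edges at the last rung. -/
lemma LadderEdge.cases_inner {u v : ℕ × Bool} (h : LadderEdge m σ u v) :
    (u.1 < m ∧ v.1 < m ∧ u.1 ≤ v.1 ∧ v.1 ≤ u.1 + 1 ∧ u ≠ v ∧
      ((ladderPoint m u).im < (ladderPoint m v).im ∨ ∃ i < m, u = (i, false) ∧ v = (i, true)) ∧
      (v.1 = u.1 + 1 → u.2 = v.2 ∨ u.2 = σ u.1 ∧ v.2 = !u.2)) ∨
    ∃ k : Fin 7, (k = 0 ∨ k = 2 ∨ k = 3 → 2 ≤ m) ∧ u = (outerLadderEdge m k).1 ∧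
      v = (outerLadderEdge m k).2 := by
  cases h with
  | @rung i hi =>
    exact Or.inl ⟨hi, hi, le_rfl, Nat.le_succ _, by simp, Or.inr ⟨i, hi, rfl, rfl⟩, by simp⟩
  | @slab i s r hi h =>
    refine Or.inl ⟨by simp; omega, hi, by simp, by simp, by simp, Or.inl ?_, fun _ => h⟩
    rw [ladderPoint_im (by omega), ladderPoint_im hi]
    push_cast
    linarith
  | outer k hk => exact Or.inr ⟨k, hk, rfl, rfl⟩

/-- An edge among the rungs below the last one against an edge at the last rung. -/
lemma meetInEnds_inner_outer (hm : 0 < m) {u v : ℕ × Bool} (hu : u.1 < m) (hv : v.1 < m)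
    (huv : u ≠ v)
    (him : (ladderPoint m u).im < (ladderPoint m v).im ∨ ∃ i < m, u = (i, false) ∧ v = (i, true))
    {k : Fin 7} (hk : k = 0 ∨ k = 2 ∨ k = 3 → 2 ≤ m) :
    MeetInEnds (ladderPoint m) u v (outerLadderEdge m k).1 (outerLadderEdge m k).2 := by
  have hm' : (1 : ℝ) ≤ m := by exact_mod_cast hm
  have p0 : ladderPoint m (0, false) = 0 := ladderPoint_zero_left
  have p1 : ladderPoint m (0, true) = 1 := ladderPoint_zero_right
  have p2 : ladderPoint m (m, false) = ⟨2 / 5, m⟩ := ladderPoint_left hm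
  have p3 : ladderPoint m (m, true) = ⟨1 / 2, 2 * m⟩ := ladderPoint_apex hm
  have hvim : (ladderPoint m v).im ≤ m - 1 := by
    obtain ⟨j, r⟩ := v
    rw [ladderPoint_im hv]
    have : ((j + 1 : ℕ) : ℝ) ≤ m := by exact_mod_cast (hv : j < m)
    push_cast at this
    linarith
  have hp (s : Bool) : (ladderPoint m (m - 1, s)).im = m - 1 := by
    rw [ladderPoint_im (by omega), Nat.cast_sub hm]
    simp
  -- the last rung and the edges to the rung before it start above or at the height of `m - 1`
  have level (c d : ℕ × Bool) (hc : c.1 ≤ m) (hd : d.1 = m)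
      (hcd : (ladderPoint m c).im < (ladderPoint m d).im)
      (hle : (m : ℝ) - 1 ≤ (ladderPoint m c).im) : MeetInEnds (ladderPoint m) u v c d := by
    refine meetInEnds_of_im_le hm hv.le hc hd.le (fun h => hcd.ne (by rw [h])) (fun h => ?_) him
      (Or.inl hcd) (hvim.trans hle)
    have : d ∈ s(u, v) := h ▸ Sym2.mem_mk_right c d
    rw [Sym2.mem_iff] at this
    rcases this with rfl | rfl <;> omega
  have line (c d : ℕ × Bool) (α β γ : ℝ)
      (hc : α * (ladderPoint m c).re + β * (ladderPoint m c).im = γ)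
      (hd : α * (ladderPoint m d).re + β * (ladderPoint m d).im = γ)
      (h : ∀ w : ℕ × Bool, w.1 < m →
        w = c ∨ α * (ladderPoint m w).re + β * (ladderPoint m w).im < γ) :
      MeetInEnds (ladderPoint m) u v c d := .of_line α β γ huv hc hd (h u hu) (h v hv)
  have cases_lt {w : ℕ × Bool} (hw : w.1 < m) :
      w = (0, false) ∧ ladderPoint m w = 0 ∨ w = (0, true) ∧ ladderPoint m w = 1 ∨
      ∃ i : ℝ, 0 < i ∧ i < m ∧ (ladderPoint m w = ⟨2 / 5, i⟩ ∨ ladderPoint m w = ⟨3 / 5, i⟩) := by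
    rcases ladderPoint_cases hw.le hm with h | h | ⟨rfl, -⟩ | ⟨i, hi, -, rfl, h⟩ |
      ⟨i, hi, him, rfl, h⟩
    · exact Or.inl h
    · exact Or.inr (Or.inl h)
    · exact absurd hw (lt_irrefl m)
    · exact Or.inr (Or.inr ⟨i, by exact_mod_cast hi, by exact_mod_cast (hw : i < m), Or.inl h⟩)
    · exact Or.inr (Or.inr ⟨i, by exact_mod_cast hi, by exact_mod_cast him, Or.inr h⟩)
  fin_cases k
  · exact level (m - 1, false) (m, false) (Nat.sub_le m 1) rfl (by rw [hp, p2]; simp) (hp _).ge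
  · exact level (m, false) (m, true) le_rfl rfl (by simp only [p2, p3]; linarith)
      (by simp only [p2]; linarith)
  · exact level (m - 1, false) (m, true) (Nat.sub_le m 1) rfl
      (by rw [hp]; simp only [p3]; linarith) (hp _).ge
  · exact level (m - 1, true) (m, true) (Nat.sub_le m 1) rfl
      (by rw [hp]; simp only [p3]; linarith) (hp _).ge
  · refine line (0, false) (m, false) (-5 * m) 2 0 (by simp [p0]) (by simp only [p2]; ring)
      fun w hw => ?_
    rcases cases_lt hw with ⟨rfl, h⟩ | ⟨rfl, h⟩ | ⟨i, hi, him, h | h⟩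
    · exact Or.inl rfl
    all_goals right; simp [h]; try linarith
  · refine line (0, false) (m, true) (-4 * m) 1 0 (by simp [p0]) (by simp only [p3]; ring)
      fun w hw => ?_
    rcases cases_lt hw with ⟨rfl, h⟩ | ⟨rfl, h⟩ | ⟨i, hi, him, h | h⟩
    · exact Or.inl rfl
    all_goals right; simp [h]; try linarith
  · refine line (0, true) (m, true) (4 * m) 1 (4 * m) (by simp [p1]) (by simp only [p3]; ring)
      fun w hw => ?_
    rcases cases_lt hw with ⟨rfl, h⟩ | ⟨rfl, h⟩ | ⟨i, hi, him, h | h⟩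
    · right; simp [h]; try linarith
    · exact Or.inl rfl
    all_goals right; simp [h]; try linarith

/-- The closed ladder is drawn without crossings. -/
theorem LadderEdge.meetInEnds (hm : 0 < m) {u v w z : ℕ × Bool} (h : LadderEdge m σ u v)
    (h' : LadderEdge m σ w z) (hne : s(u, v) ≠ s(w, z)) : MeetInEnds (ladderPoint m) u v w z := by
  rcases h.cases_inner with ⟨hu, hv, huv, huv', hne1, him, hdiag⟩ | ⟨k, hk, rfl, rfl⟩ <;>
    rcases h'.cases_inner with ⟨hw, hz, hwz, hwz', hne2, him', hdiag'⟩ | ⟨l, hl, rfl, rfl⟩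
  · have im_le {a b : ℕ × Bool} (ha : a.1 < m) (hb : b.1 < m) (hab : a.1 ≤ b.1) :
        (ladderPoint m a).im ≤ (ladderPoint m b).im := by
      obtain ⟨a, s⟩ := a
      obtain ⟨b, r⟩ := b
      rw [ladderPoint_im ha, ladderPoint_im hb]
      exact_mod_cast hab
    by_cases h1 : v.1 ≤ w.1
    · exact meetInEnds_of_im_le hm hv.le hw.le hz.le hne2 hne him him' (im_le hv hw h1)
    by_cases h2 : z.1 ≤ u.1
    · exact (meetInEnds_of_im_le hm hz.le hu.le hv.le hne1 hne.symm him' him (im_le hz hu h2)).symm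
    obtain ⟨i, s⟩ := u
    obtain ⟨j, r⟩ := v
    obtain ⟨i', s'⟩ := w
    obtain ⟨j', r'⟩ := z
    simp only at *
    obtain rfl : i = i' := by omega
    obtain rfl : j = i + 1 := by omega
    obtain rfl : j' = i + 1 := by omega
    exact meetInEnds_slab hv (hdiag rfl) (hdiag' rfl) hne
  · exact meetInEnds_inner_outer hm hu hv hne1 him hl
  · exact (meetInEnds_inner_outer hm hw hz hne2 him' hk).symm
  · have key {k l : Fin 7} (hk : k = 0 ∨ k = 2 ∨ k = 3 → 2 ≤ m)
        (hl : l = 0 ∨ l = 2 ∨ l = 3 → 2 ≤ m) (hkl : k < l) :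
        MeetInEnds (ladderPoint m) (outerLadderEdge m k).1 (outerLadderEdge m k).2
          (outerLadderEdge m l).1 (outerLadderEdge m l).2 := by
      refine meetInEnds_outerEdge (M := m) (by exact_mod_cast hm) ladderPoint_zero_left
        ladderPoint_zero_right (ladderPoint_left hm) (ladderPoint_apex hm) hkl fun h => ?_
      have h2 : 2 ≤ m := h.elim hk hl
      have hcast : ((m - 1 : ℕ) : ℝ) = m - 1 := by push_cast [Nat.cast_sub hm]; ring
      exact ⟨by exact_mod_cast h2, by rw [ladderPoint_left (by omega), hcast],
        by rw [ladderPoint_right (by omega) (by omega), hcast]⟩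
    rcases lt_trichotomy k l with hkl | rfl | hkl
    · exact key hk hl hkl
    · exact absurd rfl hne
    · exact (key hl hk hkl).symm

end Ladder

end SimpleGraph

namespace SimpleGraph

section Ladder

variable {m : ℕ}

lemma LadderEdge.rung_of_le {σ : ℕ → Bool} {i : ℕ} (hi : i ≤ m) :
    LadderEdge m σ (i, false) (i, true) := by
  rcases hi.lt_or_eq with hi | rfl
  · exact .rung hi
  · exact .outer 1 (by simp)

lemma LadderEdge.close {σ : ℕ → Bool} {s r : Bool} (h : s = r ∨ s = false) :
    LadderEdge m σ (0, s) (m, r) := by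
  cases s <;> cases r
  · exact .outer 4 (by simp)
  · exact .outer 5 (by simp)
  · simp at h
  · exact .outer 6 (by simp)

/-- For odd `m`, the alternating diagonals include one between the rungs `m - 1` and `m` that starts
on the left. -/
lemma LadderEdge.slab_of_le (hm : Odd m) {i : ℕ} {s r : Bool} (hi : i + 1 ≤ m)
    (h : s = r ∨ s = decide (Odd i) ∧ r = !s) :
    LadderEdge m (fun i => decide (Odd i)) (i, s) (i + 1, r) := by
  rcases hi.lt_or_eq with hi | rfl
  · exact .slab hi h
  · have hi : decide (Odd i) = false := by simpa [Nat.odd_add_one] using hm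
    have h' : s = r ∨ s = false := h.imp id fun h => h.1.trans hi
    rcases Nat.eq_zero_or_pos i with rfl | h0
    · exact .close h'
    · cases s <;> cases r
      · exact .outer 0 fun _ => by omega
      · exact .outer 2 fun _ => by omega
      · simp at h'
      · exact .outer 3 fun _ => by omega

/-- The edges of the great shadow of an even cycle with vertices `0, …, m`, where the vertex `i` is
on the left of the rung `i` if it is even and on the right if it is odd, and its shadow is on the
other side. The shadows are marked by `true`. -/
lemma ladderEdge_of_chord (hm : Odd m) {i j : ℕ} (hij : i < j) (hj : j ≤ m)
    (h : j = i + 1 ∨ i = 0 ∧ j = m) {e f : Bool} (hef : ¬ (e = true ∧ f = true)) :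
    LadderEdge m (fun i => decide (Odd i)) (i, xor (decide (Odd i)) e)
      (j, xor (decide (Odd j)) f) := by
  rcases h with rfl | ⟨rfl, rfl⟩
  · refine .slab_of_le hm hj ?_
    have : decide (Odd (i + 1)) = !decide (Odd i) := by
      by_cases ho : Odd i <;> simp [Nat.odd_add_one, ho]
    rw [this]
    generalize decide (Odd i) = o
    revert o e f
    decide
  · refine .close ?_
    have : decide (Odd j) = true := by simpa using hm
    rw [this]
    revert e f
    decide

end Ladder

variable {V : Type*} {G : SimpleGraph V}

/-- The great shadow of an edge or of an even cycle through `x` can be drawn in a triangle whose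
base is the edge between `x` and its shadow. -/
theorem exists_drawing_of_end_block {x b : V} {q : G.Walk x b} (hq : q.IsPath)
    (hodd : Odd q.length) (hchord : ∀ i j, i < j → j ≤ q.length →
      G.Adj (q.getVert i) (q.getVert j) → j = i + 1 ∨ i = 0 ∧ j = q.length) :
    ∃ p : V ⊕ V → ℂ, G.greatShadow.IsStraightDrawingOn {w | shadowBase w ∈ q.support} p ∧
      p (.inl x) = 0 ∧ p (.inr x) = 1 ∧ ∃ C > 0, ∀ w, shadowBase w ∈ q.support →
        shadowBase w ≠ x → p w ∈ thinTriangle C := by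
  set m := q.length with hm
  have hm0 : 0 < m := hodd.pos
  have hidx : ∀ v, ∃ i, v ∈ q.support → q.getVert i = v ∧ i ≤ m := by
    intro v
    by_cases hv : v ∈ q.support
    · obtain ⟨i, h⟩ := Walk.mem_support_iff_exists_getVert.1 hv
      exact ⟨i, fun _ => h⟩
    · exact ⟨0, fun h => absurd h hv⟩
  choose idx hidx using hidx
  let φ : V ⊕ V → ℕ × Bool := fun w =>
    (idx (shadowBase w), xor (decide (Odd (idx (shadowBase w)))) w.isRight)
  have hφle {w : V ⊕ V} (hw : shadowBase w ∈ q.support) : (φ w).1 ≤ m := (hidx _ hw).2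
  have hφinj : Set.InjOn φ {w | shadowBase w ∈ q.support} := by
    intro u hu v hv huv
    simp only [φ, Prod.mk.injEq] at huv
    have h1 : shadowBase u = shadowBase v := by
      rw [← (hidx _ hu).1, ← (hidx _ hv).1, huv.1]
    have h2 : u.isRight = v.isRight := by simpa [h1] using huv.2
    rcases u with u | u <;> rcases v with v | v <;> simp_all
  have hadj : ∀ u v : V ⊕ V, shadowBase u ∈ q.support → shadowBase v ∈ q.support →
      G.greatShadow.Adj u v → LadderEdge m (fun i => decide (Odd i)) (φ u) (φ v) ∨
        LadderEdge m (fun i => decide (Odd i)) (φ v) (φ u) := by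
    have rung (v : V) (hv : v ∈ q.support) :
        LadderEdge m (fun i => decide (Odd i)) (φ (.inl v)) (φ (.inr v)) ∨
        LadderEdge m (fun i => decide (Odd i)) (φ (.inr v)) (φ (.inl v)) := by
      have := LadderEdge.rung_of_le (σ := fun i => decide (Odd i)) (hidx v hv).2
      by_cases ho : Odd (idx v)
      · exact Or.inr (by simpa [φ, ho] using this)
      · exact Or.inl (by simpa [φ, ho] using this)
    have chord (u v : V ⊕ V) (hu : shadowBase u ∈ q.support) (hv : shadowBase v ∈ q.support)
        (huv : G.Adj (shadowBase u) (shadowBase v))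
        (h : ¬ (u.isRight = true ∧ v.isRight = true)) :
        LadderEdge m (fun i => decide (Odd i)) (φ u) (φ v) ∨
        LadderEdge m (fun i => decide (Odd i)) (φ v) (φ u) := by
      obtain ⟨hu1, hu2⟩ := hidx _ hu
      obtain ⟨hv1, hv2⟩ := hidx _ hv
      rcases lt_trichotomy (idx (shadowBase u)) (idx (shadowBase v)) with hlt | heq | hlt
      · exact Or.inl (ladderEdge_of_chord hodd hlt hv2
          (hchord _ _ hlt hv2 (by rwa [hu1, hv1])) h)
      · rw [← hu1, ← hv1, heq] at huv
        exact absurd rfl huv.ne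
      · exact Or.inr (ladderEdge_of_chord hodd hlt hu2
          (hchord _ _ hlt hu2 (by rw [hu1, hv1]; exact huv.symm)) (fun h' => h h'.symm))
    rintro (u | u) (v | v) hu hv huv
    · exact chord _ _ hu hv huv (by simp)
    · rcases huv with rfl | huv
      · exact rung u hu
      · exact chord _ _ hu hv huv (by simp)
    · rcases huv with rfl | huv
      · exact (rung u hu).symm
      · exact chord _ _ hu hv huv (by simp)
    · exact absurd huv id
  have hx : idx x = 0 := by
    have h := hidx x q.start_mem_support
    exact hq.getVert_injOn (show idx x ≤ q.length from h.2) (Nat.zero_le _) (by simpa using h.1)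
  refine ⟨fun w => ladderPoint m (φ w), ?_, ?_, ?_, 5 * m, by positivity, fun w hw hwx => ?_⟩
  · refine .of_meetInEnds ?_ ?_ ?_
    · exact (ladderPoint_injOn hm0).comp hφinj fun w hw => hφle hw
    · rintro (w | w) hw
      · exact ⟨.inr w, hw, Or.inl rfl⟩
      · exact ⟨.inl w, hw, Or.inl rfl⟩
    · intro u hu v hv w hw z hz huv hwz hne
      have hne' : s(φ u, φ v) ≠ s(φ w, φ z) := by
        intro h
        rw [Sym2.eq_iff] at h
        rcases h with ⟨h1, h2⟩ | ⟨h1, h2⟩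
        · exact hne (by rw [hφinj hu hw h1, hφinj hv hz h2])
        · exact hne (by rw [hφinj hu hz h1, hφinj hv hw h2, Sym2.eq_swap])
      have key : MeetInEnds (ladderPoint m) (φ u) (φ v) (φ w) (φ z) := by
        rcases hadj u v hu hv huv with h | h <;> rcases hadj w z hw hz hwz with h' | h'
        · exact h.meetInEnds hm0 h' hne'
        · exact (h.meetInEnds hm0 h' (by rwa [Sym2.eq_swap (a := φ z)])).swap_right
        · exact (h.meetInEnds hm0 h' (by rwa [Sym2.eq_swap (a := φ v)])).swap_left
        · exact (h.meetInEnds hm0 h' (by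
            rwa [Sym2.eq_swap (a := φ v), Sym2.eq_swap (a := φ z)])).swap_left.swap_right
      intro y hy hy'
      obtain ⟨a, ha, ha', hya⟩ := key y hy hy'
      rcases ha with rfl | rfl
      · exact ⟨u, Or.inl rfl, ha'.imp (hφinj hu hw) (hφinj hu hz), hya⟩
      · exact ⟨v, Or.inr rfl, ha'.imp (hφinj hv hw) (hφinj hv hz), hya⟩
  · simp [φ, hx, ladderPoint_zero_left]
  · simp [φ, hx, ladderPoint_zero_right]
  · refine ladderPoint_mem_thinTriangle hm0 (hφle hw) (Nat.pos_of_ne_zero fun h => hwx ?_)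
    have h' : idx (shadowBase w) = 0 := h
    rw [← (hidx _ hw).1, h', Walk.getVert_zero]

/-! ### Bipartite cactus graphs -/

/-- A straight-line drawing can be transported along an embedding of graphs. -/
lemma IsStraightDrawingOn.range {W W' : Type*} {H : SimpleGraph W} {H' : SimpleGraph W'}
    {p : W → ℂ} (h : H.IsStraightDrawingOn Set.univ p) {f : W → W'} (hf : Function.Injective f)
    (hadj : ∀ a b, H'.Adj (f a) (f b) → H.Adj a b) :
    ∃ p', H'.IsStraightDrawingOn (Set.range f) p' := by
  refine ⟨Function.extend f p 0, ?_, ?_, ?_⟩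
  · rintro _ ⟨a, rfl⟩ _ ⟨b, rfl⟩ hab
    rw [hf.extend_apply, hf.extend_apply] at hab
    rw [h.injOn (Set.mem_univ a) (Set.mem_univ b) hab]
  · rintro _ ⟨a, rfl⟩ _ ⟨b, rfl⟩ hab _ ⟨c, rfl⟩ hc
    rw [hf.extend_apply, hf.extend_apply, hf.extend_apply] at hc
    exact (h.vertex a (Set.mem_univ a) b (Set.mem_univ b) (hadj _ _ hab) c (Set.mem_univ c)
      hc).imp (congrArg f) (congrArg f)
  · rintro _ ⟨a, rfl⟩ _ ⟨b, rfl⟩ _ ⟨c, rfl⟩ _ ⟨d, rfl⟩ hab hcd hne x hx hx'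
    rw [hf.extend_apply, hf.extend_apply] at hx hx'
    obtain ⟨y, hy, hy', rfl⟩ := h.edge a (Set.mem_univ a) b (Set.mem_univ b) c (Set.mem_univ c)
      d (Set.mem_univ d) (hadj _ _ hab) (hadj _ _ hcd) (fun he => hne (by
        simpa using congrArg (Sym2.map f) he)) x hx hx'
    exact ⟨f y, hy.imp (congrArg f) (congrArg f), hy'.imp (congrArg f) (congrArg f),
      (hf.extend_apply _ _ _).symm⟩

lemma exists_drawing_greatShadow_of_subsingleton [Subsingleton V] :
    ∃ p, G.greatShadow.IsStraightDrawingOn Set.univ p := by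
  refine ⟨fun w => if w.isRight then 1 else 0, .of_meetInEnds ?_ ?_ ?_⟩
  · rintro (u | u) - (v | v) - huv <;> simp at huv
    all_goals rw [Subsingleton.elim u v]
  · rintro (w | w) -
    · exact ⟨.inr w, trivial, Or.inl rfl⟩
    · exact ⟨.inl w, trivial, Or.inl rfl⟩
  · intro u _ v _ w _ z _ huv hwz hne
    refine absurd ?_ hne
    rcases u with u | u <;> rcases v with v | v <;> rcases w with w | w <;> rcases z with z | z <;>
      simp [Subsingleton.elim v u, Subsingleton.elim w u, Subsingleton.elim z u] at huv hwz ⊢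

/-- Induction on the number of vertices: the great shadow of an end block is inserted in a thin
triangle at the edge between the vertex where the block is attached and the shadow of this
vertex. -/
theorem exists_drawing_greatShadow (n : ℕ) : ∀ {V : Type*} [Finite V] {G : SimpleGraph V},
    Nat.card V = n → G.Connected → G.IsBipartite → ¬ G.HasTripleBranch →
      ∃ p, G.greatShadow.IsStraightDrawingOn Set.univ p := by
  induction n using Nat.strong_induction_on with
  | _ n ih =>
  intro V _ G hn hG hB hT
  rcases subsingleton_or_nontrivial V with hV | hV
  · exact exists_drawing_greatShadow_of_subsingleton
  obtain ⟨x, b, q, hq, hxb, hclosed, hchord⟩ := exists_end_block hG hT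
  have hodd : Odd q.length := by
    have := two_colorable_iff_forall_loop_even.1 hB _ (.cons hxb.symm q)
    rw [Walk.length_cons, Nat.even_add_one, Nat.not_even_iff_odd] at this
    exact this
  obtain ⟨p₂, hp₂, h0, h1, C, hC, hthin⟩ := exists_drawing_of_end_block hq hodd hchord
  let K : Set V := {v | v ∈ q.support ∧ v ≠ x}
  have hK : G.IsBranchAt x K := by
    refine ⟨fun h => h.2 rfl, ⟨b, q.end_mem_support, hxb.ne'⟩, fun u hu v huv => ?_⟩
    by_cases hvx : v = x
    · exact Or.inr hvx
    · exact Or.inl ⟨hclosed u hu.1 hu.2 v huv, hvx⟩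
  obtain ⟨p₀, hp₀⟩ := ih (Nat.card ↥Kᶜ) (by
      rw [← hn]
      exact Finite.card_subtype_lt (p := fun v => v ∈ Kᶜ) (x := b)
        fun h => h ⟨q.end_mem_support, hxb.ne'⟩) rfl
    (hG.induce_compl_of_isBranchAt hK) (Colorable.of_hom (Embedding.induce Kᶜ).toHom hB)
    fun h => hT h.of_induce
  obtain ⟨p₁, hp₁⟩ := hp₀.range (H' := G.greatShadow)
    (f := Sum.map (Subtype.val : ↥Kᶜ → V) (Subtype.val : ↥Kᶜ → V))
    (Subtype.val_injective.sumMap Subtype.val_injective) (by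
      rintro (u | u) (v | v) huv
      · exact huv
      · exact huv.imp (fun h => Subtype.ext h) id
      · exact huv.imp (fun h => Subtype.ext h) id
      · exact huv)
  have hS : Set.range (Sum.map (Subtype.val : ↥Kᶜ → V) (Subtype.val : ↥Kᶜ → V)) =
      {w | shadowBase w ∉ K} := by
    ext (w | w) <;> simp
  rw [hS] at hp₁
  have huniv : {w : V ⊕ V | shadowBase w ∉ K} ∪ {w | shadowBase w ∈ q.support} = Set.univ := by
    ext w
    simp only [Set.mem_union, Set.mem_ofPred_eq, Set.mem_univ, iff_true, K]
    tauto
  rw [← huniv]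
  refine hp₁.exists_union hp₂ (α := .inl x) (β := .inr x) (Or.inl rfl) ?_ ?_ ?_ h0 h1 hC ?_
  · ext (w | w) <;> simp [K] <;> constructor <;> intro h
    · exact h.1 h.2
    · exact ⟨fun _ => h, h ▸ q.start_mem_support⟩
    · exact h.1 h.2
    · exact ⟨fun _ => h, h ▸ q.start_mem_support⟩
  · intro u _ v _ huv
    have hbase : shadowBase u = shadowBase v ∨ G.Adj (shadowBase u) (shadowBase v) := by
      rcases u with u | u <;> rcases v with v | v
      exacts [Or.inr huv, huv, huv, absurd huv id]
    by_cases hu : shadowBase u ∈ K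
    · right
      rcases hbase with h | h
      · exact ⟨hu.1, show shadowBase v ∈ q.support from h ▸ hu.1⟩
      · exact ⟨hu.1, hclosed _ hu.1 hu.2 _ h⟩
    by_cases hv : shadowBase v ∈ K
    · right
      rcases hbase with h | h
      · exact ⟨show shadowBase u ∈ q.support from h ▸ hv.1, hv.1⟩
      · exact ⟨hclosed _ hv.1 hv.2 _ h.symm, hv.1⟩
    · exact Or.inl ⟨hu, hv⟩
  · rintro (w | w) hw
    · exact ⟨.inr w, hw, Or.inl rfl⟩
    · exact ⟨.inl w, hw, Or.inl rfl⟩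
  · intro w hw hwS
    have hwK : shadowBase w ∈ K := not_not.1 hwS
    exact hthin w hw hwK.2

end SimpleGraph

theorem theorem1 {V : Type*} [Finite V] (G : SimpleGraph V) (hG : G.Connected) :
    G.greatShadow.IsPlanar ↔ G.IsBipartite ∧ G.IsCactus := by
  refine ⟨fun h => ⟨SimpleGraph.isBipartite_of_isPlanar_greatShadow h,
    SimpleGraph.isCactus_of_isPlanar_greatShadow hG h⟩, fun ⟨hB, hC⟩ => ?_⟩
  obtain ⟨p, hp⟩ := SimpleGraph.exists_drawing_greatShadow _ rfl hG hB hC.not_hasTripleBranch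
  exact hp.isPlanar
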